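/- Let $p,q,r\ge 0$ and let $\mathbb{C}l=\mathbb{C}l(p,q,r)$ be the real Clifford algebra whose generators $e_1,\dots,e_{p+q+r}$ square to $1$ ($p$ of them), $-1$ ($q$ of them) and $0$ ($r$ of them). Its dimension is $D=2^{p+q+r}$, its elements are identified with vectors of $\mathbb{R}^D$ through the basis of blades $e_I=e_{i_1}\cdots e_{i_k}$, $i_1<\dots<i_k$, and $\|\cdot\|$ is the Euclidean norm of these coordinates. Take a Sobol sequence in $[0,1]^D$, given by pairwise distinct primitive polynomials over $\mathbb{F}_2$, one for each axis (one axis may instead be of van der Corput type), and by any admissible odd initial direction numbers. Let $y_1,\dots,y_n\in[0,1]^D\subset\mathbb{C}l$ ($n\ge1$) be its first $n$ points after a nested uniform (Owen) scrambling in base $2$; this is the Sobol grid of size $n$. For $g,\varphi:\mathbb{C}l\to\mathbb{C}l$ put $$\Phi_n(x)=\sum_{i=1}^n w_i\,\varphi(x-y_i),\quad w_i=\tfrac1n\,g(y_i),\qquad h(x)=\int_{[0,1]^D}g(y)\,\varphi(x-y)\,dy .$$ There is a constant $\Gamma>0$ that depends only on $p,q,r$ and the Sobol sequence, with the following properties.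 1. Let $g,\varphi$ and $x\in\mathbb{C}l$ be such that $f_x(y)=g(y)\varphi(x-y)$ is integrable on $[0,1]^D$. Then for every $n\ge1$ the random variable $\Phi_n(x)$ is integrable and an unbiased estimator of $h(x)$, that is $\mathbb{E}[\Phi_n(x)]=h(x)$, and $$\mathbb{E}\big[\|\Phi_n(x)-h(x)\|^2\big]\le\frac{\Gamma}{n}\int_{[0,1]^D}\|f_x(y)-h(x)\|^2\,dy$$ (the right-hand side may be $+\infty$). 2. Let $\varphi$ be one of the two radial basis functions $\varphi(x)=e^{-\|x\|^2}$ and $\varphi(x)=x\,e^{-\|x\|^2}$, and let $g$ be square integrable on $[0,1]^D$. Then there is a constant $C$ such that for all $x\in\mathbb{C}l$ and all $n\ge1$ the estimator $\Phi_n(x)$ is square integrable, $\mathbb{E}[\Phi_n(x)]=h(x)$ and $$\mathbb{E}\big[\|\Phi_n(x)-h(x)\|^2\big]\le\frac{C}{n}.$$ So $\Phi_n(x)$ is an unbiased estimator of $h(x)$ with variance $O(n^{-1})$, uniformly in $x$. -/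

import Mathlib

open MeasureTheory ProbabilityTheory Polynomial

noncomputable section

/-! ## The Clifford algebra `Cl(p,q,r)` -/

/-- The squares of the generators: `p` of them are `1`, then `q` are `-1`, then `r` are `0`. -/
def cliffordSignature (p q r : ℕ) (i : Fin (p + q + r)) : ℝ :=
  if (i : ℕ) < p then 1 else if (i : ℕ) < p + q then -1 else 0

/-- The diagonal quadratic form of signature `(p,q,r)` on `ℝ^(p+q+r)`. -/
def cliffordForm (p q r : ℕ) : QuadraticForm ℝ (Fin (p + q + r) → ℝ) :=
  QuadraticMap.weightedSumSquares ℝ (cliffordSignature p q r)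

/-- The real Clifford algebra `Cl(p,q,r)`. Its multiplication is the geometric product. -/
abbrev Cl (p q r : ℕ) : Type := CliffordAlgebra (cliffordForm p q r)

/-- The generator `e_i`. -/
def cliffordGen (p q r : ℕ) (i : Fin (p + q + r)) : Cl p q r :=
  CliffordAlgebra.ι (cliffordForm p q r) (Pi.single i 1)

/-- The axes of `Cl(p,q,r)`, one for each blade `e_I` with `I ⊆ {1,…,p+q+r}`; there are
`D = 2^(p+q+r)` of them. -/
abbrev BladeIndex (p q r : ℕ) : Type := Finset (Fin (p + q + r))

/-- The basis of blades of `Cl(p,q,r)`; see `bladeBasis_apply`. -/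
def bladeBasis (p q r : ℕ) : Module.Basis (BladeIndex p q r) ℝ (Cl p q r) :=
  (Pi.basisFun ℝ (Fin (p + q + r))).ExteriorAlgebra.map
    (CliffordAlgebra.equivExterior (cliffordForm p q r)).symm

/-- The multivector with given coordinates in the basis of blades. -/
def multivector (p q r : ℕ) (u : BladeIndex p q r → ℝ) : Cl p q r :=
  ∑ I, u I • bladeBasis p q r I

/-- The coordinates of a multivector, as a vector of Euclidean space. -/
def cliffordCoords (p q r : ℕ) : Cl p q r →ₗ[ℝ] EuclideanSpace ℝ (BladeIndex p q r) :=
  (WithLp.linearEquiv 2 ℝ (BladeIndex p q r → ℝ)).symm.toLinearMap ∘ₗ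
    (bladeBasis p q r).equivFun.toLinearMap

theorem cliffordCoords_injective (p q r : ℕ) : Function.Injective (cliffordCoords p q r) :=
  (WithLp.linearEquiv 2 ℝ (BladeIndex p q r → ℝ)).symm.injective.comp
    (bladeBasis p q r).equivFun.injective

/-- The norm of a multivector is the Euclidean norm of its coordinates. -/
instance instNormedAddCommGroupCl (p q r : ℕ) : NormedAddCommGroup (Cl p q r) :=
  NormedAddCommGroup.induced (Cl p q r) (EuclideanSpace ℝ (BladeIndex p q r))
    (cliffordCoords p q r) (cliffordCoords_injective p q r)

instance instNormedSpaceCl (p q r : ℕ) : NormedSpace ℝ (Cl p q r) :=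
  NormedSpace.induced ℝ (Cl p q r) (EuclideanSpace ℝ (BladeIndex p q r)) (cliffordCoords p q r)

instance instMeasurableSpaceCl (p q r : ℕ) : MeasurableSpace (Cl p q r) := borel _

instance instBorelSpaceCl (p q r : ℕ) : BorelSpace (Cl p q r) := ⟨rfl⟩

/-! ## Radial basis functions and learnable activations -/

/-- The naive radial basis function `φ(x) = exp(-‖x‖²)`, a scalar in `Cl`. -/
def naiveRBF (p q r : ℕ) (x : Cl p q r) : Cl p q r :=
  algebraMap ℝ (Cl p q r) (Real.exp (-‖x‖ ^ 2))

/-- The Clifford radial basis function `φ(x) = x exp(-‖x‖²)`. -/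
def cliffordRBF (p q r : ℕ) (x : Cl p q r) : Cl p q r :=
  x * naiveRBF p q r x

/-- The activation `Φ(x) = ∑_{y ∈ G} w_y φ(x - y)` with grid `G` and weights `w`. -/
def activation {p q r n : ℕ} (G : Fin n → Cl p q r) (w : Fin n → Cl p q r)
    (φ : Cl p q r → Cl p q r) (x : Cl p q r) : Cl p q r :=
  ∑ i, w i * φ (x - G i)

/-! ## The Sobol sequence -/

/-- A polynomial over the field with two elements that is primitive in the sense of finite
fields: the minimal polynomial of a generator of the multiplicative group of `𝔽_{2^s}`. -/
def IsPrimitiveBinaryPoly (P : (ZMod 2)[X]) : Prop :=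
  Irreducible P ∧ orderOf (AdjoinRoot.root P) = 2 ^ P.natDegree - 1

/-- The data of a Sobol sequence with axes indexed by `ι`: pairwise distinct primitive
polynomials over `𝔽₂` together with odd initial numbers `m₁ < 2, m₂ < 4, …, m_s < 2^s`
(`init i k` is `m_{k+1}`), where `s` is the degree. The polynomial `1` stands for the van der
Corput axis (usually the first), all of whose numbers `m_k` are `1`. -/
structure SobolDesign (ι : Type*) where
  poly : ι → (ZMod 2)[X]
  poly_injective : Function.Injective poly
  poly_spec : ∀ i, poly i = 1 ∨ IsPrimitiveBinaryPoly (poly i)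
  init : ι → ℕ → ℕ
  init_odd : ∀ i k, k < (poly i).natDegree → Odd (init i k)
  init_lt : ∀ i k, k < (poly i).natDegree → init i k < 2 ^ (k + 1)

/-- The numbers `m_{k+1}` behind the direction numbers `v_{k+1} = m_{k+1} / 2^(k+1)`. For
`P = X^s + a₁ X^(s-1) + … + a_(s-1) X + 1` they follow Sobol's recurrence
`m_k = 2 a₁ m_(k-1) ⊕ 2² a₂ m_(k-2) ⊕ … ⊕ 2^(s-1) a_(s-1) m_(k-s+1) ⊕ 2^s m_(k-s) ⊕ m_(k-s)`. -/
def directionInteger (P : (ZMod 2)[X]) (init : ℕ → ℕ) (k : ℕ) : ℕ :=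
  if P.natDegree = 0 then 1
  else if k < P.natDegree then init k
  else
    ((List.finRange P.natDegree).map fun l =>
      if P.coeff (P.natDegree - ((l : ℕ) + 1)) = 1 then
        2 ^ ((l : ℕ) + 1) * directionInteger P init (k - ((l : ℕ) + 1))
      else 0).foldr Nat.xor (directionInteger P init (k - P.natDegree))
termination_by k
decreasing_by all_goals omega

/-- The binary digit of weight `2^(-(j+1))` of the direction number `v_{k+1}`. -/
def directionDigit (P : (ZMod 2)[X]) (init : ℕ → ℕ) (k j : ℕ) : ZMod 2 :=
  if j ≤ k ∧ (directionInteger P init k).testBit (k - j) then 1 else 0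

/-- The binary digit of weight `2^(-(j+1))` of the coordinate `i` of the point number `m` of the
Sobol sequence, `m = 0, 1, 2, …`. That coordinate is `b₀ v₁ ⊕ b₁ v₂ ⊕ b₂ v₃ ⊕ …` for
`m = b₀ + 2 b₁ + 2² b₂ + …` in binary. -/
def sobolDigit {ι : Type*} (S : SobolDesign ι) (i : ι) (m j : ℕ) : ZMod 2 :=
  ∑ k ∈ Finset.range m.size,
    if m.testBit k then directionDigit (S.poly i) (S.init i) k j else 0

/-! ## Nested uniform scrambling in base 2 -/

/-- The random permutations of a nested uniform (Owen) scrambling: for every axis and every finite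
string of binary digits a uniformly distributed permutation of the digits `{0,1}`, all of them
independent. -/
structure IsNestedUniformScrambling {ι Ω : Type*} [MeasurableSpace Ω] (μ : Measure Ω)
    (σ : ι → List (ZMod 2) → Ω → Equiv.Perm (ZMod 2)) : Prop where
  measurableSet_eq : ∀ i a τ, MeasurableSet {ω | σ i a ω = τ}
  uniform : ∀ i a τ, μ {ω | σ i a ω = τ} = 2⁻¹
  indep : iIndepFun (m := fun _ => ⊤) (fun (ia : ι × List (ZMod 2)) ω => σ ia.1 ia.2 ω) μ

/-- The digit after scrambling: each digit is permuted by the permutation that belongs to the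
string of the unscrambled digits before it. -/
def scrambledDigit (σ : List (ZMod 2) → Equiv.Perm (ZMod 2)) (a : ℕ → ZMod 2) (j : ℕ) : ZMod 2 :=
  σ ((List.range j).map a) (a j)

/-- The number with the binary digits `c 0, c 1, …` after the point. -/
def ofBinaryDigits (c : ℕ → ZMod 2) : ℝ :=
  ∑' j, ((c j).val : ℝ) / 2 ^ (j + 1)

/-- The point number `m` of the scrambled Sobol sequence, a random point of `[0,1]^ι`. -/
def scrambledSobol {ι Ω : Type*} (S : SobolDesign ι)
    (σ : ι → List (ZMod 2) → Ω → Equiv.Perm (ZMod 2)) (m : ℕ) (ω : Ω) : ι → ℝ :=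
  fun i => ofBinaryDigits (scrambledDigit (fun a => σ i a ω) (sobolDigit S i m))

/-! ## The estimator and its target -/

/-- The Sobol grid of size `n`: the first `n` scrambled Sobol points, as multivectors. -/
def sobolGrid {p q r : ℕ} {Ω : Type*} (S : SobolDesign (BladeIndex p q r))
    (σ : BladeIndex p q r → List (ZMod 2) → Ω → Equiv.Perm (ZMod 2)) (n : ℕ) (ω : Ω) :
    Fin n → Cl p q r :=
  fun i => multivector p q r (scrambledSobol S σ i ω)

/-- The activation on the Sobol grid with the weights `w_y = g(y) / n`, `y` in the grid. -/
def sobolActivation {p q r : ℕ} {Ω : Type*} (S : SobolDesign (BladeIndex p q r))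
    (σ : BladeIndex p q r → List (ZMod 2) → Ω → Equiv.Perm (ZMod 2))
    (g φ : Cl p q r → Cl p q r) (n : ℕ) (x : Cl p q r) (ω : Ω) : Cl p q r :=
  activation (sobolGrid S σ n ω) (fun i => (n : ℝ)⁻¹ • g (sobolGrid S σ n ω i)) φ x

/-- The Lebesgue measure on the unit cube of coordinates. -/
def cubeMeasure (p q r : ℕ) : Measure (BladeIndex p q r → ℝ) :=
  volume.restrict (Set.Icc 0 1)

/-- The integrand `f_x(y) = g(y) φ(x - y)`, as a function of the coordinates of `y`. -/
def convIntegrand {p q r : ℕ} (g φ : Cl p q r → Cl p q r) (x : Cl p q r)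
    (u : BladeIndex p q r → ℝ) : Cl p q r :=
  g (multivector p q r u) * φ (x - multivector p q r u)

/-- The convolution `h(x) = ∫_{[0,1]^D} g(y) φ(x - y) dy`. -/
def cubeConvolution {p q r : ℕ} (g φ : Cl p q r → Cl p q r) (x : Cl p q r) : Cl p q r :=
  ∫ u, convIntegrand g φ x u ∂(cubeMeasure p q r)

end

theorem cliffordForm_associated_single (p q r : ℕ) {i j : Fin (p + q + r)} (h : i ≠ j) :
    QuadraticMap.associated (R := ℝ) (-cliffordForm p q r)
      (Pi.single i (1 : ℝ)) (Pi.single j (1 : ℝ)) = 0 := by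
  have key : ∀ k : Fin (p + q + r), (Pi.single i (1 : ℝ) : Fin (p + q + r) → ℝ) k *
      (Pi.single j (1 : ℝ) : Fin (p + q + r) → ℝ) k = 0 := by
    intro k
    by_cases hk : k = i
    · subst hk; simp [h]
    · simp [hk]
  rw [map_neg, LinearMap.neg_apply, LinearMap.neg_apply, neg_eq_zero]
  rw [QuadraticMap.associated_apply]
  simp only [cliffordForm, QuadraticMap.weightedSumSquares_apply, Pi.add_apply, smul_eq_mul]
  rw [← Finset.sum_sub_distrib, ← Finset.sum_sub_distrib, Finset.sum_eq_zero]
  · simp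
  · intro k _
    linear_combination 2 * cliffordSignature p q r k * key k

open CliffordAlgebra in
theorem contractLeft_prod_eq_zero {n : ℕ} {Q : QuadraticForm ℝ (Fin n → ℝ)}
    (d : Module.Dual ℝ (Fin n → ℝ)) (l : List (Fin n))
    (h : ∀ j ∈ l, d (Pi.single j (1 : ℝ)) = 0) :
    contractLeft d (l.map fun j => ι Q (Pi.single j (1 : ℝ))).prod = 0 := by
  induction l with
  | nil => simp
  | cons a l ih =>
    rw [List.map_cons, List.prod_cons, contractLeft_ι_mul,
      ih fun j hj => h j (List.mem_cons_of_mem _ hj), h a List.mem_cons_self]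
    simp

theorem equivExterior_prod_cliffordGen (p q r : ℕ) (l : List (Fin (p + q + r))) (hl : l.Nodup) :
    CliffordAlgebra.equivExterior (cliffordForm p q r) (l.map (cliffordGen p q r)).prod =
      (l.map fun j => ExteriorAlgebra.ι ℝ (Pi.single j (1 : ℝ) : Fin (p + q + r) → ℝ)).prod := by
  induction l with
  | nil => simp
  | cons a l ih =>
    rw [List.nodup_cons] at hl
    have ih := ih hl.2
    simp only [CliffordAlgebra.equivExterior, CliffordAlgebra.changeFormEquiv_apply] at ih ⊢
    rw [List.map_cons, List.prod_cons, cliffordGen, CliffordAlgebra.changeForm_ι_mul, ih,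
      contractLeft_prod_eq_zero, sub_zero, List.map_cons, List.prod_cons]
    intro j hj
    exact cliffordForm_associated_single p q r fun e => hl.1 (e ▸ hj)

/-- The basis of blades consists of the products `e_I = e_{i₁} ⋯ e_{i_k}`, `i₁ < … < i_k`. -/
theorem bladeBasis_apply (p q r : ℕ) (I : BladeIndex p q r) :
    bladeBasis p q r I = ((I.sort (· ≤ ·)).map (cliffordGen p q r)).prod := by
  rw [bladeBasis, Module.Basis.map_apply, LinearEquiv.symm_apply_eq,
    equivExterior_prod_cliffordGen p q r _ (I.sort_nodup _), ExteriorAlgebra.basis_apply]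
  have : ∀ j : Fin I.card,
      (Set.powersetCard.ofFinEmbEquiv.symm (Set.powersetCard.prodEquiv.symm I).2) j =
        I.sort[(j : ℕ)]'(by rw [Finset.length_sort]; exact j.2) := fun j => rfl
  refine (ExteriorAlgebra.ιMulti_apply _).trans (congrArg List.prod ?_)
  apply List.ext_getElem
  · simp
  · intro k h₁ h₂
    simp
    rfl

/-! The variance of a scrambled average is diagonal in the Walsh basis, and the Sobol construction
bounds the diagonal entries uniformly.

In base 2 every digit permutation is a shift. A Walsh function of a scrambled point is therefore a
deterministic sign times a product of independent fair signs, one per node of the digit trees.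
Distinct Walsh functions are uncorrelated at any two scrambled points, and the covariance of one of
them, `A`, is a kernel that depends only on the level of `A` along each axis
(`integral_walsh_mul_walsh`). For `f = ∑ a_A walsh A` with finitely many digits, the sum over `n`
points has variance `∑ a_A²` times the kernel summed over all pairs of points, while `f` itself has
variance `∑ a_A²` (both over `A ≠ ∅`).

The kernel sums are controlled by equidistribution. By Sobol's recurrence the polynomial of an axis,
evaluated at the shift operator, lowers the row index of the generator matrix by its degree. The
first `κ i` rows of the axes are thus killed by powers of pairwise coprime polynomials. Bézout and
triangularity make them independent on `t + ∑ κ i` columns, where `t = ∑ (deg - 1)`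
(`coeff_eq_zero_of_rows`). So an aligned block of `2^(t + ∑ κ i)` points shows each digit pattern
exactly `2^t` times; for `κ ≠ 0` the kernel sums to zero over it, with absolute sum at most `Γ = 2^t
2^D`. Only the incomplete last block contributes, and the double sum is at most `Γ n`
(`abs_sum_sum_gainKernel_le`). Division by `n²` gives the rate.

Each scrambled point is uniform in the cube, whence unbiasedness. For a general integrand,
conditional expectations on finitely many digits converge almost everywhere and contract in `L²`, so
Fatou's lemma carries the bound over (`lintegral_sq_sum_digits_le`). Clifford values are treated
coordinatewise. Both radial functions are bounded, so the `L²` norm of `f_x` is bounded uniformly in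
`x`. -/

/-! ## Binary digits of direction numbers -/

/-- The binary digit of weight `2^j` of `a`, as an element of `𝔽₂`. -/
def bitZ (a j : ℕ) : ZMod 2 := if a.testBit j then 1 else 0

theorem bitZ_xor (a b j : ℕ) : bitZ (Nat.xor a b) j = bitZ a j + bitZ b j := by
  have h : Nat.xor a b = a ^^^ b := rfl
  simp only [bitZ, h, Nat.testBit_xor]
  cases a.testBit j <;> cases b.testBit j <;> decide

theorem bitZ_foldr_xor (L : List ℕ) (b j : ℕ) :
    bitZ (L.foldr Nat.xor b) j = (L.map fun a => bitZ a j).sum + bitZ b j := by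
  induction L with
  | nil => simp
  | cons a L ih => rw [List.foldr_cons, bitZ_xor, ih, List.map_cons, List.sum_cons, add_assoc]

theorem foldr_xor_lt_two_pow (L : List ℕ) (b N : ℕ) (hb : b < 2 ^ N) (hL : ∀ a ∈ L, a < 2 ^ N) :
    L.foldr Nat.xor b < 2 ^ N := by
  induction L with
  | nil => simpa
  | cons a L ih =>
    exact Nat.xor_lt_two_pow (hL a List.mem_cons_self)
      (ih fun c hc => hL c (List.mem_cons_of_mem _ hc))

theorem directionInteger_add {P : (ZMod 2)[X]} (hP : P.natDegree ≠ 0) (init : ℕ → ℕ) (k : ℕ) :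
    directionInteger P init (k + P.natDegree) =
      ((List.range P.natDegree).map fun l =>
        if P.coeff (P.natDegree - (l + 1)) = 1 then
          2 ^ (l + 1) * directionInteger P init (k + P.natDegree - (l + 1))
        else 0).foldr Nat.xor (directionInteger P init k) := by
  -- The indices of the recurrence enter as `List.finRange` coerced through the list monad; as
  -- naturals they are `List.range`.
  have hL : (do let a ← List.finRange P.natDegree; pure (a : ℕ)) = List.range P.natDegree :=
    (map_eq_pure_bind _ _).symm.trans (List.map_coe_finRange_eq_range)
  rw [directionInteger, if_neg hP, if_neg (by omega), Nat.add_sub_cancel, hL]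

/-- Initial direction numbers `m₁, …, m_s` that are odd with `m_k < 2^k`. -/
structure IsAdmissibleInit (P : (ZMod 2)[X]) (init : ℕ → ℕ) : Prop where
  odd : ∀ k, k < P.natDegree → Odd (init k)
  lt : ∀ k, k < P.natDegree → init k < 2 ^ (k + 1)

theorem directionInteger_lt {P : (ZMod 2)[X]} {init : ℕ → ℕ} (h : IsAdmissibleInit P init)
    (k : ℕ) : directionInteger P init k < 2 ^ (k + 1) := by
  induction k using Nat.strong_induction_on with
  | _ k ih =>
    by_cases hP : P.natDegree = 0
    · rw [directionInteger, if_pos hP]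
      exact Nat.one_lt_two_pow (by omega)
    by_cases hk : k < P.natDegree
    · rw [directionInteger, if_neg hP, if_pos hk]
      exact h.lt k hk
    obtain ⟨k, rfl⟩ : ∃ k', k = k' + P.natDegree := ⟨k - P.natDegree, by omega⟩
    rw [directionInteger_add hP]
    apply foldr_xor_lt_two_pow
    · exact (ih k (by omega)).trans (Nat.pow_lt_pow_right (by norm_num) (by omega))
    · intro a ha
      obtain ⟨l, hl, rfl⟩ := List.mem_map.1 ha
      have hl := List.mem_range.1 hl
      split_ifs
      · have h2 := ih (k + P.natDegree - (l + 1)) (by omega)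
        calc _ < 2 ^ (l + 1) * 2 ^ (k + P.natDegree - (l + 1) + 1) := by gcongr
          _ = 2 ^ (k + P.natDegree + 1) := by rw [← pow_add]; congr 1; omega
      · positivity

theorem bitZ_two_pow_mul (i a j : ℕ) :
    bitZ (2 ^ i * a) j = if i ≤ j then bitZ a (j - i) else 0 := by
  simp only [bitZ, Nat.testBit_two_pow_mul]
  split_ifs <;> simp_all

theorem directionDigit_eq (P : (ZMod 2)[X]) (init : ℕ → ℕ) (k j : ℕ) :
    directionDigit P init k j = if j ≤ k then bitZ (directionInteger P init k) (k - j) else 0 := by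
  simp only [directionDigit, bitZ]
  split_ifs <;> simp_all

theorem directionDigit_of_lt (P : (ZMod 2)[X]) (init : ℕ → ℕ) {k j : ℕ} (h : k < j) :
    directionDigit P init k j = 0 := by
  rw [directionDigit_eq, if_neg (by omega)]

theorem bitZ_ite (c : ZMod 2) (a : ℕ) (j : ℕ) :
    bitZ (if c = 1 then a else 0) j = c * bitZ a j := by
  have : c = 0 ∨ c = 1 := by revert c; decide
  rcases this with rfl | rfl <;> simp [bitZ]

/-- Sobol's recurrence, for the digits of the direction numbers. -/
theorem directionDigit_add {P : (ZMod 2)[X]} (hP : P.natDegree ≠ 0) {init : ℕ → ℕ}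
    (h : IsAdmissibleInit P init) (k j : ℕ) :
    directionDigit P init (k + P.natDegree) j =
      ∑ l ∈ Finset.range P.natDegree, P.coeff (P.natDegree - (l + 1)) *
        directionDigit P init (k + P.natDegree - (l + 1)) j +
      if P.natDegree ≤ j then directionDigit P init k (j - P.natDegree) else 0 := by
  set s := P.natDegree with hs
  by_cases hj : j ≤ k + s
  -- Digit `j` belongs to bit `k - j` of the integer with index `k`. The factor `2^(l+1)`
  -- compensates the drop of the index by `l + 1`, so these terms stay in row `j`; the unshifted
  -- last term falls to row `j - s`.
  · rw [directionDigit_eq, if_pos hj, directionInteger_add hP, bitZ_foldr_xor]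
    congr 1
    · rw [List.map_map]
      refine congrArg List.sum (List.map_congr_left fun l hl => ?_)
      have := List.mem_range.1 hl
      simp only [Function.comp]
      rw [bitZ_ite, bitZ_two_pow_mul, directionDigit_eq, ← hs]
      congr 1
      by_cases h1 : l + 1 ≤ k + s - j
      · rw [if_pos h1, if_pos (by omega)]
        congr 1; omega
      · rw [if_neg h1, if_neg (by omega)]
    · by_cases hsj : s ≤ j
      · rw [if_pos hsj, directionDigit_eq, if_pos (by omega)]
        congr 1; omega
      -- An integer below `2^(k+1)` has no bit at the place `k + s - j > k`.
      · rw [if_neg hsj, bitZ, Nat.testBit_lt_two_pow, if_neg (by simp)]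
        exact (directionInteger_lt h k).trans_le (Nat.pow_le_pow_right (by norm_num) (by omega))
  · rw [directionDigit_of_lt _ _ (by omega), if_pos (by omega),
      directionDigit_of_lt _ _ (by omega), add_zero, Finset.sum_eq_zero]
    intro l hl
    have := Finset.mem_range.1 hl
    rw [directionDigit_of_lt _ _ (by omega), mul_zero]

/-- Unit diagonal of the generator matrix. Initially it is the oddness of the numbers; later all
shifted terms of the recurrence lie below the diagonal, and the unshifted term is an earlier
diagonal entry. -/
theorem directionDigit_self {P : (ZMod 2)[X]} {init : ℕ → ℕ}
    (h : IsAdmissibleInit P init) (k : ℕ) : directionDigit P init k k = 1 := by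
  induction k using Nat.strong_induction_on with
  | _ k ih =>
    by_cases hP : P.natDegree = 0
    · rw [directionDigit_eq, directionInteger, if_pos hP]; simp [bitZ]
    by_cases hk : k < P.natDegree
    · rw [directionDigit_eq, directionInteger, if_neg hP, if_pos hk]
      have := Nat.odd_iff.1 (h.odd k hk)
      simp [bitZ, Nat.testBit_zero, this]
    obtain ⟨k, rfl⟩ : ∃ k', k = k' + P.natDegree := ⟨k - P.natDegree, by omega⟩
    rw [directionDigit_add hP h, if_pos (by omega), Nat.add_sub_cancel, ih k (by omega),
      Finset.sum_eq_zero, zero_add]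
    intro l hl
    have := Finset.mem_range.1 hl
    rw [directionDigit_of_lt _ _ (by omega), mul_zero]

/-! ## The shift operator on sequences -/

/-- The shift operator on sequences. -/
def seqShift (F : Type*) [CommSemiring F] : Module.End F (ℕ → F) :=
  LinearMap.funLeft F F Nat.succ

theorem seqShift_pow_apply {F : Type*} [CommSemiring F] (m : ℕ) (u : ℕ → F) (k : ℕ) :
    ((seqShift F) ^ m) u k = u (k + m) := by
  induction m generalizing k with
  | zero => simp
  | succ m ih =>
    rw [pow_succ', Module.End.mul_apply, seqShift, LinearMap.funLeft_apply, ← seqShift, ih]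
    congr 1; omega

theorem aeval_seqShift_apply {F : Type*} [CommSemiring F] (R : F[X]) (u : ℕ → F) (k : ℕ) :
    aeval (seqShift F) R u k = ∑ m ∈ Finset.range (R.natDegree + 1), R.coeff m * u (k + m) := by
  rw [aeval_eq_sum_range, LinearMap.sum_apply, Finset.sum_apply]
  simp [seqShift_pow_apply]

theorem eq_zero_of_aeval_seqShift {F : Type*} [CommRing F] {R : F[X]} (hR : R.Monic)
    {u : ℕ → F} (h : aeval (seqShift F) R u = 0) (h0 : ∀ k < R.natDegree, u k = 0) : u = 0 := by
  funext k
  induction k using Nat.strong_induction_on with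
  | _ k ih =>
    by_cases hk : k < R.natDegree
    · exact h0 k hk
    obtain ⟨k, rfl⟩ : ∃ k', k = k' + R.natDegree := ⟨k - R.natDegree, by omega⟩
    have := congrFun h k
    rw [aeval_seqShift_apply, Finset.sum_range_succ, Finset.sum_eq_zero, hR.coeff_natDegree,
      zero_add, one_mul] at this
    · exact this
    · intro m hm
      rw [ih (k + m) (by have := Finset.mem_range.1 hm; omega)]
      simp

/-- A module element killed by a coprime family decomposes uniquely. -/
theorem eq_zero_of_sum_eq_zero_of_isCoprime {F V ι : Type*} [Field F] [AddCommGroup V] [Module F V]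
    [Fintype ι] [DecidableEq ι]
    (T : Module.End F V) (Q : ι → F[X]) (hQ : Pairwise fun i j => IsCoprime (Q i) (Q j))
    (u : ι → V) (hu : ∀ i, aeval T (Q i) (u i) = 0) (hsum : ∑ i, u i = 0) (i : ι) : u i = 0 := by
  obtain ⟨a, b, hab⟩ : IsCoprime (Q i) (∏ j ∈ Finset.univ.erase i, Q j) :=
    IsCoprime.prod_right fun j hj => hQ (Finset.ne_of_mem_erase hj).symm
  have h1 : u i = - ∑ j ∈ Finset.univ.erase i, u j := by
    rw [← Finset.add_sum_erase _ _ (Finset.mem_univ i)] at hsum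
    exact eq_neg_of_add_eq_zero_left hsum
  have h2 : aeval T (∏ j ∈ Finset.univ.erase i, Q j) (u i) = 0 := by
    rw [h1, map_neg, map_sum, Finset.sum_eq_zero, neg_zero]
    intro j hj
    rw [← Finset.prod_erase_mul _ _ hj, map_mul, Module.End.mul_apply, hu, map_zero]
  calc u i = aeval T (a * Q i + b * ∏ j ∈ Finset.univ.erase i, Q j) (u i) := by rw [hab]; simp
    _ = 0 := by simp only [map_add, map_mul, LinearMap.add_apply, Module.End.mul_apply, hu, h2,
        map_zero, add_zero]

/-- Rows of generator matrices whose generating functions are the powers of coprime polynomials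
are linearly independent on sufficiently many columns. -/
theorem coeff_eq_zero_of_rows {F ι : Type*} [Field F] [Fintype ι] [DecidableEq ι]
    (Q : ι → F[X]) (hmonic : ∀ i, (Q i).Monic) (hdeg : ∀ i, 0 < (Q i).natDegree)
    (hcop : Pairwise fun i j => IsCoprime (Q i) (Q j)) (r : ι → ℕ → ℕ → F)
    (hr : ∀ i j, aeval (seqShift F) (Q i) (r i j) =
      if (Q i).natDegree ≤ j then r i (j - (Q i).natDegree) else 0)
    (hlt : ∀ i j k, k < j → r i j k = 0) (hself : ∀ i j, r i j j = 1)
    (κ : ι → ℕ) (c : ι → ℕ → F)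
    (hc : ∀ k < ∑ i, (κ i + ((Q i).natDegree - 1)),
      ∑ i, ∑ j ∈ Finset.range (κ i), c i j * r i j k = 0)
    (i : ι) (j : ℕ) (hj : j < κ i) : c i j = 0 := by
  -- Each factor `Q i` lowers the row index by its degree or kills the row.
  have hkill : ∀ i e j, j < e * (Q i).natDegree → aeval (seqShift F) (Q i ^ e) (r i j) = 0 := by
    intro i e
    induction e with
    | zero => intro j hj; omega
    | succ e ih =>
      intro j hj
      rw [pow_succ, map_mul, Module.End.mul_apply, hr]
      split_ifs with h
      · exact ih _ (by rw [add_mul] at hj; omega)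
      · exact map_zero _
  -- The ceiling of `κ i / deg`: enough to kill the first `κ i` rows, at a cost of at most `deg - 1`
  -- extra columns. This excess is the quality parameter.
  set e : ι → ℕ := fun i => (κ i + ((Q i).natDegree - 1)) / (Q i).natDegree with he
  have he1 : ∀ i, e i * (Q i).natDegree ≤ κ i + ((Q i).natDegree - 1) :=
    fun i => Nat.div_mul_le_self _ _
  have he2 : ∀ i, κ i ≤ e i * (Q i).natDegree := fun i => by
    have h1 := Nat.lt_div_mul_add (a := κ i + ((Q i).natDegree - 1)) (hdeg i)
    have h2 := hdeg i
    simp only [he]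
    omega
  set u : ι → ℕ → F := fun i => ∑ j ∈ Finset.range (κ i), c i j • r i j with hu_def
  have hu : ∀ i, aeval (seqShift F) (Q i ^ e i) (u i) = 0 := by
    intro i
    rw [hu_def]
    simp only [map_sum, map_smul]
    refine Finset.sum_eq_zero fun j hj => ?_
    rw [hkill i _ j ((Finset.mem_range.1 hj).trans_le (he2 i)), smul_zero]
  have happ : ∀ i k, u i k = ∑ j ∈ Finset.range (κ i), c i j * r i j k := by
    intro i k; simp [hu_def]
  -- The total satisfies a monic recurrence of order `∑ e i * deg` and has that many vanishing
  -- initial terms.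
  have hsum : ∑ i, u i = 0 := by
    apply eq_zero_of_aeval_seqShift (R := ∏ i, Q i ^ e i)
      (monic_prod_of_monic _ _ fun i _ => (hmonic i).pow _)
    · rw [map_sum]
      refine Finset.sum_eq_zero fun i _ => ?_
      rw [← Finset.prod_erase_mul _ _ (Finset.mem_univ i), map_mul, Module.End.mul_apply, hu,
        map_zero]
    · intro k hk
      rw [natDegree_prod_of_monic _ _ fun i _ => (hmonic i).pow _] at hk
      rw [Finset.sum_apply, ← hc k (hk.trans_le (Finset.sum_le_sum fun i _ => ?_))]
      · exact Finset.sum_congr rfl fun i _ => happ i k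
      · rw [natDegree_pow]; exact he1 i
  have hui := eq_zero_of_sum_eq_zero_of_isCoprime (seqShift F) (fun i => Q i ^ e i)
    (fun i j hij => (hcop hij).pow) u hu hsum i
  -- The rows are unitriangular, so entry `j` of the vanishing combination isolates `c i j` once the
  -- earlier coefficients are known to vanish.
  induction j using Nat.strong_induction_on with
  | _ j ih =>
    have := congrFun hui j
    rw [happ, Finset.sum_eq_single j, hself, mul_one] at this
    · exact this
    · intro l hl hlj
      rcases lt_or_gt_of_ne hlj with h | h
      · rw [ih l h (h.trans hj), zero_mul]
      · rw [hlt _ _ _ h, mul_zero]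
    · intro h; exact absurd (Finset.mem_range.2 hj) h

/-! ## Generator matrices of a Sobol design -/

namespace SobolDesign

variable {ι : Type*} (S : SobolDesign ι)

/-- The polynomial whose powers are the denominators of the generating functions of an axis. For
the van der Corput axis this is `X`. -/
noncomputable def axisPoly (i : ι) : (ZMod 2)[X] := if S.poly i = 1 then X else S.poly i

theorem isAdmissibleInit (i : ι) : IsAdmissibleInit (S.poly i) (S.init i) :=
  ⟨S.init_odd i, S.init_lt i⟩

theorem irreducible_axisPoly (i : ι) : Irreducible (S.axisPoly i) := by
  unfold axisPoly
  split_ifs with h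
  · exact irreducible_X
  · exact ((S.poly_spec i).resolve_left h).1

/-- The root is `0`, whose `orderOf` is `0` by convention and not `2^1 - 1`. Hence `X` is free to
represent the van der Corput axis without colliding with another axis. -/
theorem not_isPrimitiveBinaryPoly_X : ¬ IsPrimitiveBinaryPoly (X : (ZMod 2)[X]) := by
  rintro ⟨-, h⟩
  have h0 : AdjoinRoot.root (X : (ZMod 2)[X]) = 0 := AdjoinRoot.mk_self
  have : Fact (Irreducible (X : (ZMod 2)[X])) := ⟨irreducible_X⟩
  rw [h0, natDegree_X, orderOf_zero] at h
  norm_num at h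

theorem axisPoly_injective : Function.Injective S.axisPoly := by
  intro i j hij
  unfold axisPoly at hij
  split_ifs at hij with h1 h2 h2
  · exact S.poly_injective (h1.trans h2.symm)
  · exact absurd ((S.poly_spec j).resolve_left h2) (hij ▸ not_isPrimitiveBinaryPoly_X)
  · exact absurd ((S.poly_spec i).resolve_left h1) (hij ▸ not_isPrimitiveBinaryPoly_X)
  · exact S.poly_injective hij

theorem monic_of_ne_zero_zmod_two {P : (ZMod 2)[X]} (h : P ≠ 0) : P.Monic := by
  have h1 : P.leadingCoeff ≠ 0 := leadingCoeff_ne_zero.2 h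
  have : ∀ c : ZMod 2, c ≠ 0 → c = 1 := by decide
  exact this _ h1

theorem monic_axisPoly (i : ι) : (S.axisPoly i).Monic :=
  monic_of_ne_zero_zmod_two (S.irreducible_axisPoly i).ne_zero

theorem natDegree_axisPoly_pos (i : ι) : 0 < (S.axisPoly i).natDegree :=
  (S.irreducible_axisPoly i).natDegree_pos

theorem pairwise_isCoprime_axisPoly :
    Pairwise fun i j => IsCoprime (S.axisPoly i) (S.axisPoly j) := by
  intro i j hij
  refine ((S.irreducible_axisPoly i).isCoprime_or_dvd _).resolve_right fun hd => hij ?_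
  exact S.axisPoly_injective (eq_of_monic_of_associated (S.monic_axisPoly i) (S.monic_axisPoly j)
    ((S.irreducible_axisPoly i).associated_of_dvd (S.irreducible_axisPoly j) hd))

/-- Entry `k` of row `j` of the generator matrix of an axis. -/
def row (i : ι) (j k : ℕ) : ZMod 2 := directionDigit (S.poly i) (S.init i) k j

/-- In characteristic two, moving all shifted terms of Sobol's recurrence to one side produces the
polynomial of the axis. On the van der Corput axis the rows are unit vectors, which the shift lowers
by one, in accordance with `X`. -/
theorem aeval_seqShift_row (i : ι) (j : ℕ) :
    aeval (seqShift (ZMod 2)) (S.axisPoly i) (S.row i j) =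
      if (S.axisPoly i).natDegree ≤ j then S.row i (j - (S.axisPoly i).natDegree) else 0 := by
  funext k
  by_cases h : S.poly i = 1
  · have hd : (S.poly i).natDegree = 0 := by rw [h]; simp
    have hr : ∀ j k, S.row i j k = if j = k then 1 else 0 := by
      intro j k
      rcases lt_trichotomy j k with hjk | hjk | hjk
      · rw [row, directionDigit_eq, directionInteger, if_pos hd, if_pos hjk.le, if_neg hjk.ne,
          bitZ, if_neg (by rw [Nat.testBit_one_eq_true_iff_self_eq_zero]; omega)]
      · rw [row, if_pos hjk, hjk, directionDigit_self (S.isAdmissibleInit i)]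
      · rw [row, directionDigit_of_lt _ _ hjk, if_neg hjk.ne']
    have hX : S.axisPoly i = X := if_pos h
    rw [hX, natDegree_X, aeval_X, seqShift, LinearMap.funLeft_apply, hr]
    split_ifs with h1 h2 h2
    · rw [hr, if_pos (by omega)]
    · omega
    · rw [hr, if_neg (by omega)]
    · rfl
  · have hX : S.axisPoly i = S.poly i := if_neg h
    have hd : (S.poly i).natDegree ≠ 0 := by
      rw [← hX]; exact (S.natDegree_axisPoly_pos i).ne'
    have hc := hX ▸ (S.monic_axisPoly i).coeff_natDegree
    rw [hX, aeval_seqShift_apply, Finset.sum_range_succ, hc, one_mul, row,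
      directionDigit_add hd (S.isAdmissibleInit i), ← add_assoc]
    rw [← Finset.sum_range_reflect]
    have : ∀ a b c : ZMod 2, a = b → a + b + c = c := by decide
    rw [this]
    · split_ifs <;> rfl
    · refine Finset.sum_congr rfl fun l hl => ?_
      have := Finset.mem_range.1 hl
      rw [row]
      congr 2 <;> omega

/-- The quality parameter of the Sobol sequence. -/
noncomputable def quality [Fintype ι] : ℕ := ∑ i, ((S.axisPoly i).natDegree - 1)

/-- The digital net property: with `S.quality` spare columns, the leading rows of all axes have full
rank. -/
theorem linearIndependent_rows [Fintype ι] (κ : ι → ℕ) :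
    LinearIndependent (ZMod 2) (fun (e : (i : ι) × Fin (κ i))
      (k : Fin (S.quality + ∑ i, κ i)) => S.row e.1 e.2 k) := by
  classical
  rw [Fintype.linearIndependent_iff]
  intro g hg e
  have := coeff_eq_zero_of_rows S.axisPoly S.monic_axisPoly S.natDegree_axisPoly_pos
    S.pairwise_isCoprime_axisPoly S.row S.aeval_seqShift_row
    (fun i j k h => directionDigit_of_lt _ _ h)
    (fun i j => directionDigit_self (S.isAdmissibleInit i) j) κ
    (fun i j => if h : j < κ i then g ⟨i, ⟨j, h⟩⟩ else 0) ?_ e.1 e.2 e.2.2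
  · simpa using this
  · intro k hk
    have hk' : k < S.quality + ∑ i, κ i := by
      rw [quality, ← Finset.sum_add_distrib]
      exact hk.trans_eq (Finset.sum_congr rfl fun i _ => add_comm _ _)
    have := congrFun hg ⟨k, hk'⟩
    rw [Finset.sum_apply, Fintype.sum_sigma] at this
    rw [← this.trans (Pi.zero_apply _)]
    refine Finset.sum_congr rfl fun i _ => ?_
    rw [Finset.sum_range]
    refine Finset.sum_congr rfl fun j _ => ?_
    simp

end SobolDesign

/-! ## Equidistribution of Sobol points in elementary intervals -/

/-- Sums over the fibres of a surjective linear map between spaces over `𝔽₂`. -/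
theorem sum_comp_mulVec_add {α β : Type*} [Fintype α] [Fintype β] [DecidableEq α] [DecidableEq β]
    (A : Matrix α β (ZMod 2)) (hA : LinearIndependent (ZMod 2) A.row) (t : ℕ)
    (ht : Fintype.card β = t + Fintype.card α) (v : α → ZMod 2) (F : (α → ZMod 2) → ℝ) :
    ∑ b, F (A.mulVec b + v) = 2 ^ t * ∑ z, F z := by
  have hsurj : Function.Surjective A.mulVecLin := by
    rw [← LinearMap.range_eq_top]
    apply Submodule.eq_top_of_finrank_eq
    rw [Module.finrank_pi]
    exact hA.rank_matrix
  have hfib : ∀ z, (Finset.univ.filter fun b => A.mulVecLin b = z).card = 2 ^ t := by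
    have h1 : ∀ z, (Finset.univ.filter fun b => A.mulVecLin b = z).card =
        (Finset.univ.filter fun b => A.mulVecLin b = 0).card := fun z =>
      AddMonoidHom.card_fiber_eq_of_mem_range A.mulVecLin.toAddMonoidHom (hsurj z) (hsurj 0)
    have h2 : Fintype.card (β → ZMod 2) = ∑ z : α → ZMod 2,
        (Finset.univ.filter fun b => A.mulVecLin b = z).card :=
      Finset.card_eq_sum_card_fiberwise fun _ _ => Finset.mem_coe.2 (Finset.mem_univ _)
    simp only [h1, Finset.sum_const, Finset.card_univ, Fintype.card_fun, ZMod.card, ht, smul_eq_mul,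
      pow_add, mul_comm (2 ^ t)] at h2
    intro z
    rw [h1]
    exact (Nat.eq_of_mul_eq_mul_left (by positivity) h2).symm
  have h3 : ∑ b, F (A.mulVec b + v) = ∑ z, ∑ b with A.mulVecLin b = z, F (A.mulVec b + v) :=
    (Finset.sum_fiberwise _ _ _).symm
  rw [h3, Finset.mul_sum, ← Equiv.sum_comp (Equiv.addRight v) fun z => 2 ^ t * F z]
  refine Finset.sum_congr rfl fun z _ => ?_
  rw [Finset.sum_congr rfl fun b hb => by
    rw [← Matrix.mulVecLin_apply, (Finset.mem_filter.1 hb).2], Finset.sum_const, hfib]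
  simp

/-- The numbers below `2^M` correspond to strings of `M` binary digits. -/
theorem sum_range_two_pow_bitZ (M : ℕ) (f : (Fin M → ZMod 2) → ℝ) :
    ∑ m ∈ Finset.range (2 ^ M), f (fun k => bitZ m k) = ∑ b, f b := by
  rw [Finset.sum_range]
  have hinj : Function.Injective fun (m : Fin (2 ^ M)) (k : Fin M) => bitZ m k := by
    intro m m' h
    apply Fin.ext
    apply Nat.eq_of_testBit_eq
    intro k
    by_cases hk : k < M
    · have := congrFun h ⟨k, hk⟩
      simp only [bitZ] at this
      cases h1 : (m : ℕ).testBit k <;> cases h2 : (m' : ℕ).testBit k <;> simp_all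
    · rw [Nat.testBit_lt_two_pow (m.2.trans_le (Nat.pow_le_pow_right (by norm_num) (by omega))),
        Nat.testBit_lt_two_pow (m'.2.trans_le (Nat.pow_le_pow_right (by norm_num) (by omega)))]
  have hbij := (Fintype.bijective_iff_injective_and_card _).2 ⟨hinj, by simp⟩
  exact hbij.sum_comp f

namespace SobolDesign

variable {ι : Type*} (S : SobolDesign ι)

theorem sobolDigit_eq_sum_range (i : ι) (m j : ℕ) {L : ℕ} (hL : m.size ≤ L) :
    sobolDigit S i m j = ∑ k ∈ Finset.range L, bitZ m k * S.row i j k := by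
  have h : sobolDigit S i m j = ∑ k ∈ Finset.range m.size, bitZ m k * S.row i j k := by
    refine Finset.sum_congr rfl fun k _ => ?_
    rw [bitZ, row]
    split_ifs <;> simp
  rw [h]
  refine Finset.sum_subset (Finset.range_mono hL) fun k _ hk => ?_
  rw [bitZ, Nat.testBit_lt_two_pow, if_neg (by simp), zero_mul]
  exact (Nat.lt_size_self m).trans_le
    (Nat.pow_le_pow_right (by norm_num) (by simpa using hk))

/-- The two summands have disjoint binary supports, so their sum is their exclusive or. -/
theorem bitZ_mul_two_pow_add (a M : ℕ) {m : ℕ} (hm : m < 2 ^ M) (k : ℕ) :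
    bitZ (2 ^ M * a + m) k = bitZ m k + bitZ (2 ^ M * a) k := by
  have h : 2 ^ M * a + m = Nat.xor (2 ^ M * a) m := by
    change _ = 2 ^ M * a ^^^ m
    apply Nat.eq_of_testBit_eq
    intro j
    rw [Nat.testBit_two_pow_mul_add _ hm, Nat.testBit_xor, Nat.testBit_two_pow_mul]
    split_ifs with h
    · simp [not_le.2 h]
    · rw [Nat.testBit_lt_two_pow (x := m)
        (hm.trans_le (Nat.pow_le_pow_right (by norm_num) (by omega)))]
      simp [not_lt.1 h]
  rw [h, bitZ_xor, add_comm]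

/-- Within an aligned block the high bits of the index are fixed, so the digits are an affine
function of its `M` low bits. -/
theorem sobolDigit_block (i : ι) (a M j : ℕ) {m : ℕ} (hm : m < 2 ^ M) :
    sobolDigit S i (2 ^ M * a + m) j =
      ∑ k : Fin M, S.row i j k * bitZ m k + sobolDigit S i (2 ^ M * a) j := by
  have hL : ∀ x, x ≤ 2 ^ M * a + m → x.size ≤ M + (2 ^ M * a + m).size := fun x hx =>
    (Nat.size_le_size hx).trans (Nat.le_add_left _ _)
  have hm' : m.size ≤ M := Nat.size_le.2 hm
  rw [S.sobolDigit_eq_sum_range i _ j (hL _ le_rfl),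
    S.sobolDigit_eq_sum_range i (2 ^ M * a) j (hL _ (Nat.le_add_right _ _)),
    ← Finset.sum_range fun k => S.row i j k * bitZ m k]
  simp only [bitZ_mul_two_pow_add a M hm, add_mul, Finset.sum_add_distrib]
  rw [← S.sobolDigit_eq_sum_range i m j (hm'.trans (Nat.le_add_right _ _)),
    S.sobolDigit_eq_sum_range i m j hm']
  simp only [mul_comm]

/-- Every aligned block of `2^(t + ∑ κ)` Sobol points has `2^t` points in each elementary interval
of level `κ`. -/
theorem sum_block_eq [Fintype ι] [DecidableEq ι] (κ : ι → ℕ) (a : ℕ)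
    (F : (((i : ι) × Fin (κ i)) → ZMod 2) → ℝ) :
    ∑ m ∈ Finset.range (2 ^ (S.quality + ∑ i, κ i)),
      F (fun e => sobolDigit S e.1 (2 ^ (S.quality + ∑ i, κ i) * a + m) e.2) =
    2 ^ S.quality * ∑ z, F z := by
  set M := S.quality + ∑ i, κ i with hM
  let A : Matrix ((i : ι) × Fin (κ i)) (Fin M) (ZMod 2) := fun e k => S.row e.1 e.2 k
  rw [← sum_comp_mulVec_add A (S.linearIndependent_rows κ) S.quality (by simp [hM])
    (fun e => sobolDigit S e.1 (2 ^ M * a) e.2) F, ← sum_range_two_pow_bitZ M]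
  refine Finset.sum_congr rfl fun m hm => congrArg F (funext fun e => ?_)
  rw [S.sobolDigit_block _ _ _ _ (Finset.mem_range.1 hm)]
  rfl

end SobolDesign

/-! ## Gain coefficients -/

/-- The sign `(-1)^v`. -/
def zsgn (v : ZMod 2) : ℝ := if v = 0 then 1 else -1

theorem zsgn_zero : zsgn 0 = 1 := if_pos rfl

theorem zsgn_add (u v : ZMod 2) : zsgn (u + v) = zsgn u * zsgn v := by
  have : ∀ v : ZMod 2, v = 0 ∨ v = 1 := by decide
  have h11 : (1 + 1 : ZMod 2) = 0 := by decide
  rcases this u with rfl | rfl <;> rcases this v with rfl | rfl <;> simp [zsgn, h11]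

theorem zsgn_mul_self (v : ZMod 2) : zsgn v * zsgn v = 1 := by
  unfold zsgn; split_ifs <;> norm_num

theorem abs_zsgn (v : ZMod 2) : |zsgn v| = 1 := by
  unfold zsgn; split_ifs <;> norm_num

theorem sum_zsgn : ∑ v, zsgn v = 0 := by
  have : (Finset.univ : Finset (ZMod 2)) = {0, 1} := by decide
  rw [this, Finset.sum_pair (by decide)]
  simp [zsgn]

/-- The factor of the gain coefficient at one digit: agreement of the digits, except at the last
digit of the axis. -/
def gainFactor (last : Prop) [Decidable last] (u v : ZMod 2) : ℝ :=
  if last then zsgn u * zsgn v else if u = v then 1 else 0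

theorem gainFactor_comm (last : Prop) [Decidable last] (u v : ZMod 2) :
    gainFactor last u v = gainFactor last v u := by
  unfold gainFactor; rw [mul_comm]; simp only [eq_comm]

theorem sum_gainFactor {last : Prop} [Decidable last] (h : last) (v : ZMod 2) :
    ∑ u, gainFactor last u v = 0 := by
  simp only [gainFactor, if_pos h, ← Finset.sum_mul, sum_zsgn, zero_mul]

theorem sum_abs_gainFactor (last : Prop) [Decidable last] (v : ZMod 2) :
    ∑ u, |gainFactor last u v| = if last then 2 else 1 := by
  unfold gainFactor
  split_ifs
  · simp [abs_mul, abs_zsgn]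
  · simp [apply_ite]

/-- The kernel of the Walsh functions of level `κ` under nested uniform scrambling. -/
def gainKernel {ι : Type*} [Fintype ι] (κ : ι → ℕ) (x y : ι → ℕ → ZMod 2) : ℝ :=
  ∏ e : (i : ι) × Fin (κ i), gainFactor ((e.2 : ℕ) + 1 = κ e.1) (x e.1 e.2) (y e.1 e.2)

theorem gainKernel_comm {ι : Type*} [Fintype ι] (κ : ι → ℕ) (x y : ι → ℕ → ZMod 2) :
    gainKernel κ x y = gainKernel κ y x :=
  Finset.prod_congr rfl fun _ _ => gainFactor_comm _ _ _

theorem gainKernel_self {ι : Type*} [Fintype ι] (κ : ι → ℕ) (x : ι → ℕ → ZMod 2) :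
    gainKernel κ x x = 1 :=
  Finset.prod_eq_one fun _ _ => by simp [gainFactor, zsgn_mul_self]

/-- Each axis has at most one last digit and so contributes at most a factor `2`. -/
theorem prod_sigma_last_le {ι : Type*} [Fintype ι] (κ : ι → ℕ) :
    ∏ e : (i : ι) × Fin (κ i), (if (e.2 : ℕ) + 1 = κ e.1 then (2 : ℝ) else 1) ≤
      2 ^ Fintype.card ι := by
  rw [Fintype.prod_sigma, ← Finset.card_univ, ← Finset.prod_const]
  refine Finset.prod_le_prod (fun i _ => Finset.prod_nonneg fun j _ => by split_ifs <;> norm_num)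
    fun i _ => ?_
  rw [Finset.prod_ite, Finset.prod_const, Finset.prod_const_one, mul_one]
  calc (2 : ℝ) ^ _ ≤ 2 ^ 1 := by
        refine pow_le_pow_right₀ (by norm_num) (Finset.card_le_one.2 fun a ha b hb => ?_)
        have h1 := (Finset.mem_filter.1 ha).2
        have h2 := (Finset.mem_filter.1 hb).2
        apply Fin.ext
        simp only at h1 h2
        omega
    _ = 2 := pow_one 2

/-- A symmetric kernel that sums to zero over aligned blocks of length `B` has small sums over
initial segments. -/
theorem abs_sum_sum_le_of_blocks (G : ℕ → ℕ → ℝ) (hsymm : ∀ m m', G m m' = G m' m) (B : ℕ)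
    (hB : 0 < B) (h0 : ∀ a m', ∑ m ∈ Finset.range B, G (B * a + m) m' = 0) (C : ℝ)
    (hC : ∀ a m', ∑ m ∈ Finset.range B, |G (B * a + m) m'| ≤ C) (n : ℕ) :
    |∑ m ∈ Finset.range n, ∑ m' ∈ Finset.range n, G m m'| ≤ C * n := by
  have hblocks : ∀ q m', ∑ m ∈ Finset.range (B * q), G m m' = 0 := by
    intro q m'
    induction q with
    | zero => simp
    | succ q ih => rw [mul_add, mul_one, Finset.sum_range_add, ih, h0, add_zero]
  obtain ⟨q, ρ, hρ, rfl⟩ : ∃ q ρ, ρ < B ∧ n = B * q + ρ :=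
    ⟨n / B, n % B, Nat.mod_lt _ hB, (Nat.div_add_mod n B).symm⟩
  have hrest : ∀ m', ∑ m ∈ Finset.range (B * q + ρ), G m m' =
      ∑ m ∈ Finset.range ρ, G (B * q + m) m' := fun m' => by
    rw [Finset.sum_range_add, hblocks, zero_add]
  have hC0 : 0 ≤ C := (Finset.sum_nonneg fun _ _ => abs_nonneg _).trans (hC 0 0)
  -- By symmetry, complete blocks cancel in either variable. What remains is the square of the `ρ`
  -- leftover indices, and each of its lines lies inside one block.
  calc |∑ m ∈ Finset.range (B * q + ρ), ∑ m' ∈ Finset.range (B * q + ρ), G m m'|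
      = |∑ m' ∈ Finset.range ρ, ∑ m ∈ Finset.range ρ, G (B * q + m) (B * q + m')| := by
        rw [Finset.sum_comm]
        simp only [hrest]
        rw [Finset.sum_comm]
        congr 1
        rw [Finset.sum_comm, Finset.sum_range_add]
        rw [Finset.sum_comm, Finset.sum_eq_zero, zero_add]
        intro m _
        rw [← hblocks q (B * q + m)]
        exact Finset.sum_congr rfl fun _ _ => hsymm _ _
    _ ≤ ∑ m' ∈ Finset.range ρ, |∑ m ∈ Finset.range ρ, G (B * q + m) (B * q + m')| :=
        Finset.abs_sum_le_sum_abs _ _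
    _ ≤ ∑ m' ∈ Finset.range ρ, C := Finset.sum_le_sum fun m' _ =>
        (Finset.abs_sum_le_sum_abs _ _).trans ((Finset.sum_le_sum_of_subset_of_nonneg
          (Finset.range_mono hρ.le) fun _ _ _ => abs_nonneg _).trans (hC q _))
    _ = C * ρ := by simp [mul_comm]
    _ ≤ C * (B * q + ρ : ℕ) := by gcongr; omega

namespace SobolDesign

variable {ι : Type*} [Fintype ι] (S : SobolDesign ι)

/-- The bound for the gain coefficients of the Sobol sequence. -/
noncomputable def gain : ℝ := 2 ^ S.quality * 2 ^ Fintype.card ι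

theorem gain_pos : 0 < S.gain := by unfold gain; positivity

/-- Equidistribution turns a block sum of the kernel into a product of sums over single digits. The
last digit of an axis with `κ i ≠ 0` gives the factor zero; in absolute value a last digit gives `2`
and any other `1`. -/
theorem abs_sum_sum_gainKernel_le (κ : ι → ℕ) (hκ : κ ≠ 0) (n : ℕ) :
    |∑ m ∈ Finset.range n, ∑ m' ∈ Finset.range n,
      gainKernel κ (fun i => sobolDigit S i m) (fun i => sobolDigit S i m')| ≤ S.gain * n := by
  classical
  apply abs_sum_sum_le_of_blocks _ (fun m m' => gainKernel_comm _ _ _)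
    (2 ^ (S.quality + ∑ i, κ i)) (by positivity)
  · intro a m'
    refine (S.sum_block_eq κ a fun z => ∏ e : (i : ι) × Fin (κ i),
      gainFactor ((e.2 : ℕ) + 1 = κ e.1) (z e) (sobolDigit S e.1 m' e.2)).trans ?_
    have := Finset.prod_univ_sum (fun _ : (i : ι) × Fin (κ i) => (Finset.univ : Finset (ZMod 2)))
      fun e u => gainFactor ((e.2 : ℕ) + 1 = κ e.1) u (sobolDigit S e.1 m' e.2)
    rw [Fintype.piFinset_univ] at this
    rw [← this]
    obtain ⟨i, hi⟩ := Function.ne_iff.1 hκ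
    have hi : κ i ≠ 0 := hi
    rw [Finset.prod_eq_zero (Finset.mem_univ ⟨i, ⟨κ i - 1, by omega⟩⟩), mul_zero]
    exact sum_gainFactor (by simp only; omega) _
  · intro a m'
    refine (S.sum_block_eq κ a fun z => |∏ e : (i : ι) × Fin (κ i),
      gainFactor ((e.2 : ℕ) + 1 = κ e.1) (z e) (sobolDigit S e.1 m' e.2)|).trans_le ?_
    have := Finset.prod_univ_sum (fun _ : (i : ι) × Fin (κ i) => (Finset.univ : Finset (ZMod 2)))
      fun e u => |gainFactor ((e.2 : ℕ) + 1 = κ e.1) u (sobolDigit S e.1 m' e.2)|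
    rw [Fintype.piFinset_univ] at this
    simp only [Finset.abs_prod]
    rw [← this]
    simp only [sum_abs_gainFactor]
    rw [gain]
    gcongr
    exact prod_sigma_last_le κ

end SobolDesign

/-! ## Walsh functions -/

theorem measurable_zsgn : Measurable zsgn := Measurable.of_discrete

/-- The Walsh function of a finite set of digits. -/
def walsh {α : Type*} (A : Finset α) (x : α → ZMod 2) : ℝ := ∏ e ∈ A, zsgn (x e)

theorem abs_walsh {α : Type*} (A : Finset α) (x : α → ZMod 2) : |walsh A x| = 1 := by
  rw [walsh, Finset.abs_prod]
  exact Finset.prod_eq_one fun _ _ => abs_zsgn _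

theorem measurable_walsh {α : Type*} (A : Finset α) : Measurable (walsh A) :=
  Finset.measurable_fun_prod _ fun e _ => measurable_zsgn.comp (measurable_pi_apply e)

/-- A function of finitely many binary digits is a combination of Walsh functions. -/
theorem exists_eq_sum_walsh {α : Type*} [DecidableEq α] (T : Finset α)
    (f : (α → ZMod 2) → ℝ) (hf : DependsOn f (T : Set α)) :
    ∃ a : Finset α → ℝ, ∀ x, f x = ∑ A ∈ T.powerset, a A * walsh A x := by
  induction T using Finset.induction_on generalizing f with
  | empty =>
    refine ⟨fun _ => f 0, fun x => ?_⟩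
    simp [walsh, hf (x := x) (y := 0) (by simp)]
  | insert e T he ih =>
    have hdep : ∀ v : ZMod 2, DependsOn (fun x => f (Function.update x e v)) (T : Set α) := by
      intro v x y hxy
      refine hf fun i hi => ?_
      by_cases hie : i = e
      · subst hie; simp
      · rw [Function.update_of_ne hie, Function.update_of_ne hie]
        exact hxy i (by simpa [hie] using hi)
    obtain ⟨a0, h0⟩ := ih _ (hdep 0)
    obtain ⟨a1, h1⟩ := ih _ (hdep 1)
    refine ⟨fun A => if e ∈ A then (a0 (A.erase e) - a1 (A.erase e)) / 2 else (a0 A + a1 A) / 2,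
      fun x => ?_⟩
    rw [Finset.sum_powerset_insert he, ← Finset.sum_add_distrib]
    -- Even and odd parts of `f` in the digit `e`; both are free of `e`.
    have hx : f x = (f (Function.update x e 0) + f (Function.update x e 1)) / 2 +
        zsgn (x e) * ((f (Function.update x e 0) - f (Function.update x e 1)) / 2) := by
      have : x e = 0 ∨ x e = 1 := by generalize x e = v; revert v; decide
      have hself := Function.update_eq_self e x
      rcases this with h | h <;> rw [h] at hself <;> rw [hself, h]
      · rw [zsgn_zero]; ring
      · rw [zsgn, if_neg (by decide)]; ring
    rw [hx, h0, h1, ← Finset.sum_add_distrib, ← Finset.sum_sub_distrib, Finset.sum_div,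
      Finset.sum_div, Finset.mul_sum, ← Finset.sum_add_distrib]
    refine Finset.sum_congr rfl fun A hA => ?_
    have heA : e ∉ A := fun h => he (Finset.mem_powerset.1 hA h)
    have hw : walsh (insert e A) x = zsgn (x e) * walsh A x := Finset.prod_insert heA
    simp only [heA, if_false, Finset.mem_insert_self, if_true, Finset.erase_insert heA, hw]
    ring

/-- The level of a finite set of digits along an axis: the number of digits up to the last one. -/
def digitLevel {ι : Type*} [DecidableEq ι] (A : Finset (ι × ℕ)) (i : ι) : ℕ :=
  (A.filter fun e => e.1 = i).sup fun e => e.2 + 1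

section digitLevel

variable {ι : Type*} [DecidableEq ι]

theorem lt_digitLevel {A : Finset (ι × ℕ)} {e : ι × ℕ} (he : e ∈ A) :
    e.2 < digitLevel A e.1 :=
  Finset.le_sup (f := fun e : ι × ℕ => e.2 + 1) (Finset.mem_filter.2 ⟨he, rfl⟩)

theorem exists_mem_digitLevel {A : Finset (ι × ℕ)} {i : ι} (h : digitLevel A i ≠ 0) :
    ∃ j, (i, j) ∈ A ∧ j + 1 = digitLevel A i := by
  have hne : (A.filter fun e => e.1 = i).Nonempty := by
    by_contra hn
    rw [Finset.not_nonempty_iff_eq_empty] at hn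
    exact h (by rw [digitLevel, hn, Finset.sup_empty]; rfl)
  obtain ⟨e, he, h2⟩ := Finset.exists_mem_eq_sup _ hne fun e : ι × ℕ => e.2 + 1
  obtain ⟨hA, rfl⟩ := Finset.mem_filter.1 he
  exact ⟨e.2, hA, h2.symm⟩

theorem digitLevel_ne_zero {A : Finset (ι × ℕ)} (hA : A ≠ ∅) : digitLevel A ≠ 0 := by
  obtain ⟨e, he⟩ := Finset.nonempty_iff_ne_empty.2 hA
  intro h
  have := lt_digitLevel he
  rw [h] at this
  exact absurd this (Nat.not_lt_zero _)

variable [Fintype ι]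

/-- Before the last digit of `A` on an axis the two points agree, so their signs there square to
one. Only last digits matter, which is why the kernel sees just the level of `A`. -/
theorem gainKernel_digitLevel_of_agree (A : Finset (ι × ℕ)) (x y : ι → ℕ → ZMod 2)
    (h : ∀ e ∈ A, ∀ l < e.2, x e.1 l = y e.1 l) :
    gainKernel (digitLevel A) x y =
      walsh A (fun e => x e.1 e.2) * walsh A (fun e => y e.1 e.2) := by
  let φ : ((i : ι) × Fin (digitLevel A i)) → ι × ℕ := fun e => (e.1, e.2)
  have hφ : Function.Injective φ := by
    rintro ⟨i, j⟩ ⟨i', j'⟩ hij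
    obtain ⟨h1, h2⟩ := Prod.mk.inj hij
    dsimp only at h1 h2
    subst h1
    rw [Fin.ext h2]
  have hA : A ⊆ Finset.univ.image φ := fun e he =>
    Finset.mem_image.2 ⟨⟨e.1, ⟨e.2, lt_digitLevel he⟩⟩, Finset.mem_univ _, rfl⟩
  have hprod : ∏ e ∈ A, zsgn (x e.1 e.2) * zsgn (y e.1 e.2) =
      ∏ e ∈ Finset.univ.image φ, if e ∈ A then zsgn (x e.1 e.2) * zsgn (y e.1 e.2) else 1 := by
    rw [Finset.prod_ite_mem, Finset.inter_eq_right.2 hA]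
  rw [walsh, walsh, ← Finset.prod_mul_distrib, hprod, Finset.prod_image fun a _ b _ hab => hφ hab]
  refine Finset.prod_congr rfl fun ⟨i, j⟩ _ => ?_
  obtain ⟨k, hk, hk'⟩ := exists_mem_digitLevel (A := A) (i := i) (by have := j.2; omega)
  simp only [gainFactor, φ]
  split_ifs with h1 h2 h2 h3 h3
  · rfl
  · exact absurd (by rwa [show k = j by omega] at hk) h2
  · rw [h2, zsgn_mul_self]
  · rfl
  · exact absurd (h _ hk j (by have := j.2; simp only; omega)) h2
  · exact absurd (h _ hk j (by have := j.2; simp only; omega)) h2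

theorem gainKernel_digitLevel_of_not_agree (A : Finset (ι × ℕ)) (x y : ι → ℕ → ZMod 2)
    (h : ¬ ∀ e ∈ A, ∀ l < e.2, x e.1 l = y e.1 l) : gainKernel (digitLevel A) x y = 0 := by
  push Not at h
  obtain ⟨e, he, l, hl, hne⟩ := h
  have := lt_digitLevel he
  apply Finset.prod_eq_zero (Finset.mem_univ ⟨e.1, ⟨l, hl.trans this⟩⟩)
  simp only [gainFactor]
  rw [if_neg (by omega), if_neg hne]

end digitLevel

/-! ## Walsh functions of scrambled points -/

section scramble

variable {ι Ω : Type*}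

/-- The scrambled digits of the point with digits `x`, for all axes. -/
def scrambleDigits (σ : ι → List (ZMod 2) → Ω → Equiv.Perm (ZMod 2)) (x : ι → ℕ → ZMod 2)
    (ω : Ω) (e : ι × ℕ) : ZMod 2 :=
  scrambledDigit (fun a => σ e.1 a ω) (x e.1) e.2

/-- The place of the permutation that acts on a digit of the point with digits `x`. -/
def scrambleNode (x : ι → ℕ → ZMod 2) (e : ι × ℕ) : ι × List (ZMod 2) :=
  (e.1, (List.range e.2).map (x e.1))

/-- The random shifts of digits that make up a scrambling in base 2. -/
def scrambleShift (σ : ι → List (ZMod 2) → Ω → Equiv.Perm (ZMod 2)) (ia : ι × List (ZMod 2))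
    (ω : Ω) : ZMod 2 := σ ia.1 ia.2 ω 0

/-- Both permutations of `ZMod 2` are translations; this is the use of base 2. -/
theorem scrambleDigits_eq (σ : ι → List (ZMod 2) → Ω → Equiv.Perm (ZMod 2))
    (x : ι → ℕ → ZMod 2) (ω : Ω) (e : ι × ℕ) :
    scrambleDigits σ x ω e = x e.1 e.2 + scrambleShift σ (scrambleNode x e) ω := by
  have : ∀ (τ : Equiv.Perm (ZMod 2)) (a : ZMod 2), τ a = a + τ 0 := by decide
  exact this _ _

/-- A node records the axis, the place of the digit (as the length of the string) and all preceding
digits. -/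
theorem eq_of_scrambleNode_eq {x y : ι → ℕ → ZMod 2} {e e' : ι × ℕ}
    (h : scrambleNode x e = scrambleNode y e') :
    e = e' ∧ ∀ l < e.2, x e.1 l = y e.1 l := by
  obtain ⟨i, j⟩ := e
  obtain ⟨i', j'⟩ := e'
  obtain ⟨h1, h2⟩ := Prod.mk.inj h
  dsimp only at h1 h2
  subst h1
  have h3 : j = j' := by simpa using congrArg List.length h2
  subst h3
  exact ⟨rfl, fun l hl => List.map_inj_left.1 h2 l (List.mem_range.2 hl)⟩

theorem scrambleNode_injective (x : ι → ℕ → ZMod 2) : Function.Injective (scrambleNode x) :=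
  fun _ _ h => (eq_of_scrambleNode_eq h).1

theorem scrambleNode_congr {x y : ι → ℕ → ZMod 2} {e : ι × ℕ}
    (h : ∀ l < e.2, x e.1 l = y e.1 l) : scrambleNode x e = scrambleNode y e :=
  Prod.ext rfl (List.map_inj_left.2 fun l hl => h l (List.mem_range.1 hl))

theorem walsh_scrambleDigits [DecidableEq ι] (σ : ι → List (ZMod 2) → Ω → Equiv.Perm (ZMod 2))
    (x : ι → ℕ → ZMod 2) (A : Finset (ι × ℕ)) (ω : Ω) :
    walsh A (scrambleDigits σ x ω) = walsh A (fun e => x e.1 e.2) *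
      walsh (A.image (scrambleNode x)) fun ia => scrambleShift σ ia ω := by
  rw [walsh, walsh, walsh, Finset.prod_image fun a _ b _ h => scrambleNode_injective x h,
    ← Finset.prod_mul_distrib]
  exact Finset.prod_congr rfl fun e _ => by rw [scrambleDigits_eq, zsgn_add]

theorem walsh_mul_walsh {α : Type*} [DecidableEq α] (A B : Finset α) (x : α → ZMod 2) :
    walsh A x * walsh B x = walsh (symmDiff A B) x := by
  have hAB : walsh A x = walsh (A \ B) x * walsh (A ∩ B) x :=
    (Finset.sdiff_inter_self_left A B ▸ Finset.prod_sdiff Finset.inter_subset_left).symm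
  have hBA : walsh B x = walsh (B \ A) x * walsh (A ∩ B) x :=
    (Finset.sdiff_inter_self_right B A ▸ Finset.prod_sdiff Finset.inter_subset_right).symm
  have hsq : walsh (A ∩ B) x * walsh (A ∩ B) x = 1 := by
    rw [walsh, ← Finset.prod_mul_distrib]
    exact Finset.prod_eq_one fun _ _ => zsgn_mul_self _
  have hs : walsh (symmDiff A B) x = walsh (A \ B) x * walsh (B \ A) x :=
    Finset.prod_union disjoint_sdiff_sdiff
  rw [hs, hAB, hBA]
  linear_combination walsh (A \ B) x * walsh (B \ A) x * hsq

variable [MeasurableSpace Ω] {μ : Measure Ω}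
  {σ : ι → List (ZMod 2) → Ω → Equiv.Perm (ZMod 2)}

/-- The uniform distribution on binary digits. -/
noncomputable def uniformDigit : Measure (ZMod 2) := (2⁻¹ : ENNReal) • Measure.count

instance : IsProbabilityMeasure uniformDigit := ⟨by
  rw [uniformDigit, Measure.smul_apply, Measure.count_univ, ENat.card_eq_coe_fintype_card,
    ZMod.card, smul_eq_mul]
  exact ENNReal.inv_mul_cancel (by norm_num) (by norm_num)⟩

theorem integral_uniformDigit {E : Type*} [NormedAddCommGroup E] [NormedSpace ℝ E]
    [CompleteSpace E] (f : ZMod 2 → E) :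
    ∫ v, f v ∂uniformDigit = (2⁻¹ : ℝ) • (f 0 + f 1) := by
  have : (Finset.univ : Finset (ZMod 2)) = {0, 1} := by decide
  rw [uniformDigit, integral_smul_measure, integral_count, this, Finset.sum_pair (by decide)]
  simp

/-! ### Law and covariances of scrambled digits -/

namespace IsNestedUniformScrambling

theorem measurable_perm (h : IsNestedUniformScrambling μ σ) (i : ι) (a : List (ZMod 2)) :
    Measurable[_, ⊤] (σ i a) :=
  @measurable_to_countable' _ _ ⊤ _ _ _ fun τ => h.measurableSet_eq i a τ

theorem measurable_scrambleShift (h : IsNestedUniformScrambling μ σ) (ia : ι × List (ZMod 2)) :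
    Measurable (scrambleShift σ ia) :=
  (measurable_from_top (f := fun τ : Equiv.Perm (ZMod 2) => τ 0)).comp
    (h.measurable_perm ia.1 ia.2)

theorem map_scrambleShift (h : IsNestedUniformScrambling μ σ) (ia : ι × List (ZMod 2)) :
    μ.map (scrambleShift σ ia) = uniformDigit := by
  refine Measure.ext_of_singleton fun v => ?_
  rw [Measure.map_apply (h.measurable_scrambleShift ia) (measurableSet_singleton v)]
  have hτ : ∀ (τ : Equiv.Perm (ZMod 2)) (v : ZMod 2), τ 0 = v ↔ τ = Equiv.addRight v := by decide
  have : scrambleShift σ ia ⁻¹' {v} = {ω | σ ia.1 ia.2 ω = Equiv.addRight v} := by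
    ext ω; exact hτ _ _
  rw [this, h.uniform, uniformDigit]
  simp

theorem iIndepFun_scrambleShift (h : IsNestedUniformScrambling μ σ) :
    iIndepFun (scrambleShift σ) μ :=
  h.indep.comp (fun _ τ => τ 0) fun _ => measurable_from_top

theorem measurable_scrambleDigits (h : IsNestedUniformScrambling μ σ) (x : ι → ℕ → ZMod 2) :
    Measurable (scrambleDigits σ x) := by
  refine measurable_pi_lambda _ fun e => ?_
  simp only [scrambleDigits_eq]
  exact (Measurable.of_discrete (f := fun v => x e.1 e.2 + v)).comp (h.measurable_scrambleShift _)

/-- Each scrambled point has independent uniformly distributed digits. -/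
theorem map_scrambleDigits [Countable ι] (h : IsNestedUniformScrambling μ σ)
    (x : ι → ℕ → ZMod 2) :
    μ.map (scrambleDigits σ x) = Measure.infinitePi fun _ => uniformDigit := by
  have hi : iIndepFun (fun e ω => scrambleDigits σ x ω e) μ := by
    simp only [scrambleDigits_eq]
    exact (h.iIndepFun_scrambleShift.precomp (scrambleNode_injective x)).comp
      (fun e v => x e.1 e.2 + v) fun e => Measurable.of_discrete
  have hm : ∀ e, Measurable fun ω => scrambleDigits σ x ω e := fun e =>
    (measurable_pi_apply e).comp (h.measurable_scrambleDigits x)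
  refine (hi.map_fun_eq_infinitePi_map hm).trans ?_
  congr 1
  funext e
  simp only [scrambleDigits_eq]
  refine (Measure.map_map (g := fun v => x e.1 e.2 + v) Measurable.of_discrete
    (h.measurable_scrambleShift (scrambleNode x e))).symm.trans ?_
  rw [h.map_scrambleShift]
  refine Measure.ext_of_singleton fun v => ?_
  have : (fun w => x e.1 e.2 + w) ⁻¹' {v} = {v - x e.1 e.2} := by
    ext w; simp only [Set.mem_preimage, Set.mem_singleton_iff, eq_sub_iff_add_eq']
  rw [Measure.map_apply Measurable.of_discrete (measurableSet_singleton v), this, uniformDigit]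
  simp

/-- By independence the mean factorizes, and every single sign has mean zero. -/
theorem integral_walsh_scrambleShift (h : IsNestedUniformScrambling μ σ)
    (B : Finset (ι × List (ZMod 2))) (hB : B ≠ ∅) :
    ∫ ω, walsh B (fun ia => scrambleShift σ ia ω) ∂μ = 0 := by
  have hi : iIndepFun (fun (b : B) ω => zsgn (scrambleShift σ b ω)) μ :=
    (h.iIndepFun_scrambleShift.precomp Subtype.val_injective).comp (fun _ => zsgn)
      fun _ => measurable_zsgn
  have h1 := hi.integral_fun_prod_eq_prod_integral fun b =>
    (measurable_zsgn.comp (h.measurable_scrambleShift b)).aestronglyMeasurable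
  obtain ⟨b, hb⟩ := Finset.nonempty_iff_ne_empty.2 hB
  simp only [walsh]
  rw [integral_congr_ae (.of_forall fun ω => (Finset.prod_coe_sort B
    fun ia => zsgn (scrambleShift σ ia ω)).symm), h1]
  refine Finset.prod_eq_zero (Finset.mem_univ ⟨b, hb⟩) ?_
  rw [← integral_map (f := zsgn) (h.measurable_scrambleShift b).aemeasurable
    measurable_zsgn.aestronglyMeasurable, h.map_scrambleShift, integral_uniformDigit]
  simp [zsgn]

/-- Covariances of Walsh functions of scrambled points. -/
theorem integral_walsh_mul_walsh [DecidableEq ι] [Fintype ι] [IsProbabilityMeasure μ]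
    (h : IsNestedUniformScrambling μ σ) (x y : ι → ℕ → ZMod 2) (A B : Finset (ι × ℕ)) :
    ∫ ω, walsh A (scrambleDigits σ x ω) * walsh B (scrambleDigits σ y ω) ∂μ =
      if A = B then gainKernel (digitLevel A) x y else 0 := by
  have hmul : ∀ ω, walsh A (scrambleDigits σ x ω) * walsh B (scrambleDigits σ y ω) =
      walsh A (fun e => x e.1 e.2) * walsh B (fun e => y e.1 e.2) *
        walsh (symmDiff (A.image (scrambleNode x)) (B.image (scrambleNode y)))
          fun ia => scrambleShift σ ia ω := fun ω => by
    rw [← walsh_mul_walsh, walsh_scrambleDigits, walsh_scrambleDigits]; ring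
  simp only [hmul]
  rw [integral_const_mul]
  -- The mean survives only if the two sets of nodes coincide, that is, if `A = B` and the points
  -- agree before every digit of `A`.
  by_cases hAB : A.image (scrambleNode x) = B.image (scrambleNode y)
  · have hsub : ∀ (x y : ι → ℕ → ZMod 2) (A B : Finset (ι × ℕ)),
        A.image (scrambleNode x) = B.image (scrambleNode y) → ∀ e ∈ A,
          e ∈ B ∧ ∀ l < e.2, x e.1 l = y e.1 l := by
      intro x y A B hAB e he
      obtain ⟨e', he', h1⟩ := Finset.mem_image.1 (hAB ▸ Finset.mem_image_of_mem _ he)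
      obtain ⟨rfl, h2⟩ := eq_of_scrambleNode_eq h1.symm
      exact ⟨he', h2⟩
    have hEq : A = B := Finset.Subset.antisymm (fun e he => (hsub x y A B hAB e he).1)
      fun e he => (hsub y x B A hAB.symm e he).1
    subst hEq
    rw [if_pos rfl, hAB, symmDiff_self,
      gainKernel_digitLevel_of_agree A x y fun e he => (hsub x y A A hAB e he).2]
    simp [walsh]
  · rw [h.integral_walsh_scrambleShift _ fun h0 => hAB (symmDiff_eq_bot.1 h0), mul_zero]
    split_ifs with hEq
    · subst hEq
      rw [gainKernel_digitLevel_of_not_agree]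
      exact fun hag => hAB (Finset.image_congr fun e he => scrambleNode_congr (hag e he))
    · rfl

theorem integrable_walsh_mul_walsh [IsFiniteMeasure μ]
    (h : IsNestedUniformScrambling μ σ) (x y : ι → ℕ → ZMod 2) (A B : Finset (ι × ℕ)) :
    Integrable (fun ω => walsh A (scrambleDigits σ x ω) * walsh B (scrambleDigits σ y ω)) μ := by
  refine Integrable.of_bound (((measurable_walsh A).comp (h.measurable_scrambleDigits x)).mul
    ((measurable_walsh B).comp (h.measurable_scrambleDigits y))).aestronglyMeasurable 1
    (.of_forall fun ω => ?_)
  rw [Real.norm_eq_abs, abs_mul, abs_walsh, abs_walsh, one_mul]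

/-- Expand the square: terms with different Walsh functions are uncorrelated, so only the diagonal
in `A` remains. -/
theorem integral_sq_sum_walsh [DecidableEq ι] [Fintype ι] [IsProbabilityMeasure μ]
    (h : IsNestedUniformScrambling μ σ) (x : ℕ → ι → ℕ → ZMod 2) (s : Finset ℕ)
    (𝒜 : Finset (Finset (ι × ℕ))) (a : Finset (ι × ℕ) → ℝ) :
    ∫ ω, (∑ m ∈ s, ∑ A ∈ 𝒜, a A * walsh A (scrambleDigits σ (x m) ω)) ^ 2 ∂μ =
      ∑ A ∈ 𝒜, a A ^ 2 * ∑ m ∈ s, ∑ m' ∈ s, gainKernel (digitLevel A) (x m) (x m') := by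
  have hsq : ∀ ω, (∑ m ∈ s, ∑ A ∈ 𝒜, a A * walsh A (scrambleDigits σ (x m) ω)) ^ 2 =
      ∑ A ∈ 𝒜, ∑ B ∈ 𝒜, ∑ m ∈ s, ∑ m' ∈ s, a A * a B *
        (walsh A (scrambleDigits σ (x m) ω) * walsh B (scrambleDigits σ (x m') ω)) := by
    intro ω
    rw [Finset.sum_comm, sq, Finset.sum_mul_sum]
    refine Finset.sum_congr rfl fun A _ => Finset.sum_congr rfl fun B _ => ?_
    rw [Finset.sum_mul_sum]
    exact Finset.sum_congr rfl fun m _ => Finset.sum_congr rfl fun m' _ => by ring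
  have hint : ∀ A B m m', Integrable (fun ω => a A * a B *
      (walsh A (scrambleDigits σ (x m) ω) * walsh B (scrambleDigits σ (x m') ω))) μ :=
    fun A B m m' => (h.integrable_walsh_mul_walsh _ _ A B).const_mul _
  simp only [hsq]
  rw [integral_finsetSum _ fun A _ => integrable_finsetSum _ fun B _ => integrable_finsetSum _
    fun m _ => integrable_finsetSum _ fun m' _ => hint A B m m']
  refine Finset.sum_congr rfl fun A hA => ?_
  rw [integral_finsetSum _ fun B _ => integrable_finsetSum _
    fun m _ => integrable_finsetSum _ fun m' _ => hint A B m m', Finset.sum_eq_single A]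
  · rw [integral_finsetSum _ fun m _ => integrable_finsetSum _ fun m' _ => hint A A m m',
      Finset.mul_sum]
    refine Finset.sum_congr rfl fun m _ => ?_
    rw [integral_finsetSum _ fun m' _ => hint A A m m', Finset.mul_sum]
    refine Finset.sum_congr rfl fun m' _ => ?_
    rw [integral_const_mul, h.integral_walsh_mul_walsh, if_pos rfl, sq]
  · intro B _ hBA
    rw [integral_finsetSum _ fun m _ => integrable_finsetSum _ fun m' _ => hint A B m m']
    refine Finset.sum_eq_zero fun m _ => ?_
    rw [integral_finsetSum _ fun m' _ => hint A B m m']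
    refine Finset.sum_eq_zero fun m' _ => ?_
    rw [integral_const_mul, h.integral_walsh_mul_walsh, if_neg hBA.symm, mul_zero]
  · exact fun hn => absurd hA hn

/-- The variance bound for functions of finitely many digits. -/
theorem integral_sq_sum_le_of_dependsOn [DecidableEq ι] [Fintype ι] [IsProbabilityMeasure μ]
    (h : IsNestedUniformScrambling μ σ) (S : SobolDesign ι) (T : Finset (ι × ℕ))
    (f : (ι × ℕ → ZMod 2) → ℝ) (hf : DependsOn f (T : Set (ι × ℕ))) (n : ℕ) :
    ∫ ω, (∑ m ∈ Finset.range n, (f (scrambleDigits σ (fun i => sobolDigit S i m) ω) -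
        ∫ z, f z ∂(Measure.infinitePi fun _ => uniformDigit))) ^ 2 ∂μ ≤
      S.gain * n * ∫ z, (f z - ∫ z, f z ∂(Measure.infinitePi fun _ => uniformDigit)) ^ 2
        ∂(Measure.infinitePi fun _ => uniformDigit) := by
  obtain ⟨a, ha⟩ := exists_eq_sum_walsh T f hf
  set x : ℕ → ι → ℕ → ZMod 2 := fun m i => sobolDigit S i m with hx
  have hfm : Measurable f := by
    rw [show f = fun x => ∑ A ∈ T.powerset, a A * walsh A x from funext ha]
    exact Finset.measurable_fun_sum _ fun A _ => (measurable_walsh A).const_mul _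
  have hmean : ∫ z, f z ∂(Measure.infinitePi fun _ => uniformDigit) = a ∅ := by
    rw [← h.map_scrambleDigits (x 0), integral_map (h.measurable_scrambleDigits _).aemeasurable
      hfm.aestronglyMeasurable]
    -- The factor `walsh ∅ = 1` makes the mean a covariance with the constant.
    have hE : ∀ ω, f (scrambleDigits σ (x 0) ω) = ∑ A ∈ T.powerset, a A *
        (walsh A (scrambleDigits σ (x 0) ω) * walsh ∅ (scrambleDigits σ (x 0) ω)) := fun ω => by
      simp [ha, walsh]
    simp only [hE]
    rw [integral_finsetSum _ fun A _ => (h.integrable_walsh_mul_walsh _ _ A ∅).const_mul _,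
      Finset.sum_eq_single ∅]
    · rw [integral_const_mul, h.integral_walsh_mul_walsh, if_pos rfl, gainKernel_self, mul_one]
    · intro A _ hA
      rw [integral_const_mul, h.integral_walsh_mul_walsh, if_neg hA, mul_zero]
    · exact fun hn => absurd (Finset.empty_mem_powerset T) hn
  have hcent : ∀ z, f z - a ∅ = ∑ A ∈ T.powerset.erase ∅, a A * walsh A z := fun z => by
    rw [ha, ← Finset.add_sum_erase _ _ (Finset.empty_mem_powerset T)]
    simp [walsh]
  rw [hmean, ← h.map_scrambleDigits (x 0), integral_map
    (h.measurable_scrambleDigits _).aemeasurable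
    ((hfm.sub_const _).pow_const 2).aestronglyMeasurable]
  -- One scrambled point is already uniform, so the same formula for a single point computes the
  -- variance of `f` as `∑ a_A²`.
  have h1 := h.integral_sq_sum_walsh x {0} (T.powerset.erase ∅) a
  simp only [Finset.sum_singleton, gainKernel_self, mul_one] at h1
  simp only [hcent]
  rw [h1, h.integral_sq_sum_walsh x, Finset.mul_sum]
  refine Finset.sum_le_sum fun A hA => ?_
  rw [mul_comm]
  exact mul_le_mul_of_nonneg_right ((le_abs_self _).trans (S.abs_sum_sum_gainKernel_le _
    (digitLevel_ne_zero (Finset.ne_of_mem_erase hA)) n)) (sq_nonneg _)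

end IsNestedUniformScrambling

end scramble

/-! ## Uniform binary digits and Lebesgue measure -/

section binary

open Filter Topology

/-- The law of independent uniform binary digits. -/
noncomputable abbrev uniformDigits (α : Type*) : Measure (α → ZMod 2) :=
  Measure.infinitePi fun _ => uniformDigit

theorem summable_binaryDigits (c : ℕ → ZMod 2) :
    Summable fun j => ((c j).val : ℝ) / 2 ^ (j + 1) := by
  refine Summable.of_nonneg_of_le (fun j => by positivity) (fun j => ?_)
    ((summable_geometric_of_lt_one (by norm_num) (by norm_num : (1 / 2 : ℝ) < 1)).mul_right 1)
  have h : ((c j).val : ℝ) ≤ 1 := by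
    have := ZMod.val_lt (c j)
    exact_mod_cast Nat.lt_succ_iff.1 this
  rw [mul_one, one_div, inv_pow, ← one_div]
  exact div_le_div₀ (by norm_num) h (by positivity) (pow_le_pow_right₀ (by norm_num) (by omega))

theorem tendsto_sum_binaryDigits (c : ℕ → ZMod 2) :
    Tendsto (fun N => ∑ j ∈ Finset.range N, ((c j).val : ℝ) / 2 ^ (j + 1)) atTop
      (𝓝 (ofBinaryDigits c)) :=
  (summable_binaryDigits c).hasSum.tendsto_sum_nat

theorem measurable_sum_binaryDigits (N : ℕ) : Measurable fun c : ℕ → ZMod 2 =>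
    ∑ j ∈ Finset.range N, ((c j).val : ℝ) / 2 ^ (j + 1) :=
  Finset.measurable_fun_sum _ fun j _ =>
    (Measurable.of_discrete (f := fun v : ZMod 2 => (v.val : ℝ) / 2 ^ (j + 1))).comp
      (measurable_pi_apply j)

theorem measurable_ofBinaryDigits : Measurable ofBinaryDigits :=
  measurable_of_tendsto_metrizable measurable_sum_binaryDigits
    (tendsto_pi_nhds.2 tendsto_sum_binaryDigits)

/-- The characteristic function of the uniform distribution on `[0,1]`. -/
noncomputable def unitCharFun (t : ℝ) : ℂ := ∫ u in (0:ℝ)..1, Complex.exp (t * u * Complex.I)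

theorem continuous_unitCharFun : Continuous unitCharFun :=
  intervalIntegral.continuous_parametric_intervalIntegral_of_continuous' (by fun_prop) 0 1

/-- Splitting `[0,1]` at `1/2` amounts to conditioning on the first binary digit. -/
theorem unitCharFun_eq_half (t : ℝ) :
    unitCharFun t = (2⁻¹ : ℝ) • (1 + Complex.exp ((t / 2 : ℝ) * Complex.I)) *
      unitCharFun (t / 2) := by
  have hc : Continuous fun u : ℝ => Complex.exp (t * u * Complex.I) := by fun_prop
  have h1 : ∫ u in (0:ℝ)..(1/2), Complex.exp (t * u * Complex.I) =
      (2⁻¹ : ℝ) • unitCharFun (t / 2) := by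
    have := intervalIntegral.smul_integral_comp_mul_left (a := 0) (b := 1)
      (fun u : ℝ => Complex.exp (t * u * Complex.I)) (1 / 2)
    rw [mul_zero, mul_one] at this
    rw [← this, unitCharFun, one_div]
    congr 1
    refine intervalIntegral.integral_congr fun u _ => ?_
    congr 1
    push_cast
    ring
  have h2 : ∫ u in (1/2:ℝ)..1, Complex.exp (t * u * Complex.I) =
      (2⁻¹ : ℝ) • (Complex.exp ((t / 2 : ℝ) * Complex.I) * unitCharFun (t / 2)) := by
    have := intervalIntegral.smul_integral_comp_mul_add (a := 0) (b := 1)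
      (fun u : ℝ => Complex.exp (t * u * Complex.I)) (1 / 2) (1 / 2)
    rw [mul_zero, mul_one, zero_add, add_halves] at this
    rw [← this, unitCharFun, one_div, ← intervalIntegral.integral_const_mul]
    congr 1
    refine intervalIntegral.integral_congr fun u _ => ?_
    rw [← Complex.exp_add]
    congr 1
    push_cast
    ring
  rw [unitCharFun, ← intervalIntegral.integral_add_adjacent_intervals
    (hc.intervalIntegrable 0 (1/2)) (hc.intervalIntegrable _ _), h1, h2]
  simp only [Complex.real_smul]
  ring

theorem unitCharFun_eq_prod (t : ℝ) (N : ℕ) :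
    unitCharFun t = (∏ j ∈ Finset.range N,
      (2⁻¹ : ℝ) • (1 + Complex.exp ((t / 2 ^ (j + 1) : ℝ) * Complex.I))) *
        unitCharFun (t / 2 ^ N) := by
  induction N with
  | zero => simp
  | succ N ih =>
    rw [ih, unitCharFun_eq_half (t / 2 ^ N), Finset.prod_range_succ, div_div, ← pow_succ, mul_assoc]

theorem integral_exp_sum_binaryDigits (t : ℝ) (N : ℕ) :
    ∫ c, Complex.exp (t * (∑ j ∈ Finset.range N, ((c j).val : ℝ) / 2 ^ (j + 1) : ℝ) * Complex.I)
      ∂(uniformDigits ℕ) = ∏ j ∈ Finset.range N,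
        (2⁻¹ : ℝ) • (1 + Complex.exp ((t / 2 ^ (j + 1) : ℝ) * Complex.I)) := by
  let g : Fin N → ZMod 2 → ℂ := fun j v =>
    Complex.exp (((v.val : ℝ) * (t / 2 ^ ((j : ℕ) + 1)) : ℝ) * Complex.I)
  have hexp : ∀ c : ℕ → ZMod 2, Complex.exp (t * (∑ j ∈ Finset.range N,
      ((c j).val : ℝ) / 2 ^ (j + 1) : ℝ) * Complex.I) = ∏ j : Fin N, g j (c j) := fun c => by
    rw [← Complex.exp_sum, Finset.sum_range, ← Finset.sum_mul]
    congr 2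
    push_cast
    rw [Finset.mul_sum]
    exact Finset.sum_congr rfl fun j _ => by ring
  have hi : iIndepFun (fun (j : Fin N) (c : ℕ → ZMod 2) => g j (c j)) (uniformDigits ℕ) :=
    ((iIndepFun_infinitePi (P := fun _ : ℕ => uniformDigit) (X := fun _ v => v)
      fun _ => measurable_id).precomp Fin.val_injective).comp g fun _ => Measurable.of_discrete
  simp only [hexp]
  rw [hi.integral_fun_prod_eq_prod_integral fun j =>
    ((Measurable.of_discrete (f := g j)).comp
      (measurable_pi_apply (j : ℕ))).aestronglyMeasurable,
    Finset.prod_range]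
  refine Finset.prod_congr rfl fun j _ => ?_
  have hmap := Measure.infinitePi_map_eval (fun _ : ℕ => uniformDigit) (j : ℕ)
  have := integral_map (μ := uniformDigits ℕ) (f := g j) (measurable_pi_apply (j : ℕ)).aemeasurable
    Measurable.of_discrete.aestronglyMeasurable
  rw [← this, hmap, integral_uniformDigit]
  simp [g, ZMod.val_one, -ZMod.natCast_val]

/-- The number with independent uniform binary digits is uniformly distributed on `[0,1]`. -/
theorem map_ofBinaryDigits :
    (uniformDigits ℕ).map ofBinaryDigits = volume.restrict (Set.Icc (0:ℝ) 1) := by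
  have : IsProbabilityMeasure ((uniformDigits ℕ).map ofBinaryDigits) :=
    Measure.isProbabilityMeasure_map measurable_ofBinaryDigits.aemeasurable
  refine Measure.ext_of_charFun (funext fun t => ?_)
  have hR : charFun (volume.restrict (Set.Icc (0:ℝ) 1)) t = unitCharFun t := by
    rw [charFun_apply_real, integral_Icc_eq_integral_Ioc, unitCharFun,
      intervalIntegral.integral_of_le zero_le_one]
  rw [hR, charFun_apply_real, integral_map measurable_ofBinaryDigits.aemeasurable (by fun_prop)]
  set p : ℕ → ℂ := fun N => ∏ j ∈ Finset.range N,
    (2⁻¹ : ℝ) • (1 + Complex.exp ((t / 2 ^ (j + 1) : ℝ) * Complex.I)) with hp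
  have h1 : Tendsto p atTop (𝓝 (∫ c, Complex.exp (t * ofBinaryDigits c * Complex.I)
      ∂(uniformDigits ℕ))) := by
    simp only [hp, ← integral_exp_sum_binaryDigits]
    refine tendsto_integral_of_dominated_convergence (fun _ => 1) (fun N => ?_)
      (integrable_const _) (fun N => .of_forall fun c => ?_) (.of_forall fun c => ?_)
    · have := measurable_sum_binaryDigits N
      exact Measurable.aestronglyMeasurable (by fun_prop)
    · rw [← Complex.ofReal_mul, Complex.norm_exp_ofReal_mul_I]
    · exact ((Complex.continuous_exp.comp (by fun_prop :
        Continuous fun r : ℝ => (t * r * Complex.I : ℂ))).tendsto _).comp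
          (tendsto_sum_binaryDigits c)
  -- The tail factor of the product formula tends to its value at `0`, so both characteristic
  -- functions are the limit of the same products.
  have h2 : Tendsto (fun N : ℕ => unitCharFun (t / 2 ^ N)) atTop (𝓝 1) := by
    have h0 : unitCharFun 0 = 1 := by simp [unitCharFun]
    rw [← h0]
    refine (continuous_unitCharFun.tendsto 0).comp ?_
    have := (tendsto_pow_atTop_nhds_zero_of_lt_one (r := (1/2:ℝ)) (by norm_num)
      (by norm_num)).const_mul t
    simpa [div_eq_mul_inv] using this
  have h3 := h1.mul h2
  simp only [hp, ← unitCharFun_eq_prod, mul_one] at h3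
  exact tendsto_nhds_unique h3 tendsto_const_nhds |>.symm ▸ rfl

/-- The point of the cube with the given binary digits. -/
noncomputable def cubePoint {ι : Type*} (x : ι × ℕ → ZMod 2) (i : ι) : ℝ :=
  ofBinaryDigits fun j => x (i, j)

theorem measurable_cubePoint {ι : Type*} : Measurable (cubePoint (ι := ι)) :=
  measurable_pi_lambda _ fun i => measurable_ofBinaryDigits.comp
    (measurable_pi_lambda _ fun j => measurable_pi_apply (i, j))

/-- The point with independent uniform binary digits is uniformly distributed in the cube. -/
theorem map_cubePoint {ι : Type*} [Fintype ι] :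
    (uniformDigits (ι × ℕ)).map (cubePoint (ι := ι)) = volume.restrict (Set.Icc 0 1) := by
  have h1 : cubePoint (ι := ι) = (fun x i => ofBinaryDigits (x i)) ∘
      MeasurableEquiv.curry ι ℕ (ZMod 2) := rfl
  have hm : Measurable fun (x : ι → ℕ → ZMod 2) i => ofBinaryDigits (x i) :=
    measurable_pi_lambda _ fun i => measurable_ofBinaryDigits.comp (measurable_pi_apply i)
  have hp : ∀ _ : ι, IsProbabilityMeasure ((uniformDigits ℕ).map ofBinaryDigits) := fun _ =>
    Measure.isProbabilityMeasure_map measurable_ofBinaryDigits.aemeasurable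
  rw [h1, ← Measure.map_map hm (MeasurableEquiv.measurable _),
    Measure.infinitePi_map_curry (fun (_ : ι) (_ : ℕ) => uniformDigit), Measure.infinitePi_eq_pi,
    Measure.pi_map_pi (f := fun _ => ofBinaryDigits) fun _ => measurable_ofBinaryDigits.aemeasurable]
  simp only [map_ofBinaryDigits]
  rw [← Measure.restrict_pi_pi, Set.pi_univ_Icc]
  rfl

end binary

/-! ## Approximation by functions of finitely many digits -/

section approximation

open Filter Topology

/-- The filtration of the digits in an increasing sequence of finite sets. -/
def digitFiltration {α : Type*} (T : ℕ → Finset α) (hT : Monotone T) :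
    Filtration ℕ (MeasurableSpace.pi (X := fun _ : α => ZMod 2)) where
  seq N := Filtration.piFinset (T N)
  mono' _ _ h := Filtration.piFinset.mono (hT h)
  le' N := Filtration.piFinset.le (T N)

theorem iSup_digitFiltration {α : Type*} (T : ℕ → Finset α) (hT : Monotone T)
    (hex : ∀ e, ∃ N, e ∈ T N) :
    ⨆ N, digitFiltration T hT N = MeasurableSpace.pi (X := fun _ : α => ZMod 2) := by
  refine le_antisymm (iSup_le fun N => (digitFiltration T hT).le N) (iSup_le fun e => ?_)
  obtain ⟨N, hN⟩ := hex e
  refine le_iSup_of_le N ?_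
  have h : (fun z : α → ZMod 2 => z e) = (fun z : T N → ZMod 2 => z ⟨e, hN⟩) ∘ (T N).restrict := rfl
  rw [h, ← MeasurableSpace.comap_comp]
  exact MeasurableSpace.comap_mono (measurable_pi_apply _).comap_le

/-- Lévy's upward theorem. The limit is a conditional expectation on all digits; it is the function
itself after passing to a strongly measurable version of `F`. -/
theorem tendsto_ae_condExp_digitFiltration {α : Type*} (T : ℕ → Finset α) (hT : Monotone T)
    (hex : ∀ e, ∃ N, e ∈ T N) (P : Measure (α → ZMod 2)) [IsFiniteMeasure P]
    (F : (α → ZMod 2) → ℝ) (hF : Integrable F P) :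
    ∀ᵐ z ∂P, Tendsto (fun N => P[F | digitFiltration T hT N] z) atTop (𝓝 (F z)) := by
  have hG := hF.congr hF.1.ae_eq_mk
  have h := tendsto_ae_condExp (ℱ := digitFiltration T hT) (μ := P) (hF.1.mk F)
  rw [iSup_digitFiltration T hT hex, condExp_of_stronglyMeasurable le_rfl
    hF.1.stronglyMeasurable_mk hG] at h
  have hc : ∀ᵐ z ∂P, ∀ N, P[F | digitFiltration T hT N] z =
      P[hF.1.mk F | digitFiltration T hT N] z :=
    ae_all_iff.2 fun N => condExp_congr_ae hF.1.ae_eq_mk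
  filter_upwards [h, hc, hF.1.ae_eq_mk] with z h1 h2 h3
  simp only [h2]
  rwa [h3]

theorem lintegral_enorm_sq_eq {α E : Type*} {m : MeasurableSpace α} [NormedAddCommGroup E]
    (μ : Measure α) (f : α → E) : ∫⁻ a, ‖f a‖ₑ ^ 2 ∂μ = eLpNorm f 2 μ ^ 2 := by
  have := eLpNorm_nnreal_pow_eq_lintegral (μ := μ) (f := f) (p := 2) (by norm_num)
  simpa using this.symm

/-- Conditional expectation fixes constants and contracts in `L²`. With lower integrals this needs
only `F ∈ L¹`, the right side being possibly infinite. -/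
theorem lintegral_condExp_sub_sq_le {α : Type*} {m m0 : MeasurableSpace α} (P : Measure α)
    [IsFiniteMeasure P] (hm : m ≤ m0) (F : α → ℝ) (hF : Integrable F P) (c : ℝ) :
    ∫⁻ z, ‖P[F | m] z - c‖ₑ ^ 2 ∂P ≤ ∫⁻ z, ‖F z - c‖ₑ ^ 2 ∂P := by
  have h1 : P[F - fun _ => c | m] =ᵐ[P] fun z => P[F | m] z - c := by
    have := condExp_sub hF (integrable_const c) m
    rwa [condExp_const hm] at this
  rw [lintegral_enorm_sq_eq, lintegral_enorm_sq_eq P fun z => F z - c, ← eLpNorm_congr_ae h1]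
  gcongr
  exact eLpNorm_condExp_le_eLpNorm _ (by norm_num)

theorem DependsOn.measurable_and_bounded {α : Type*} {T : Finset α}
    {f : (α → ZMod 2) → ℝ} (hf : DependsOn f (T : Set α)) :
    Measurable f ∧ ∃ C, ∀ z, |f z| ≤ C := by
  classical
  obtain ⟨a, ha⟩ := exists_eq_sum_walsh T f hf
  constructor
  · rw [funext ha]
    exact Finset.measurable_fun_sum _ fun A _ => (measurable_walsh A).const_mul _
  · refine ⟨∑ A ∈ T.powerset, |a A|, fun z => ?_⟩
    rw [ha]
    refine (Finset.abs_sum_le_sum_abs _ _).trans (Finset.sum_le_sum fun A _ => ?_)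
    rw [abs_mul, abs_walsh, mul_one]

theorem enorm_sq_eq_ofReal (r : ℝ) : ‖r‖ₑ ^ 2 = ENNReal.ofReal (r ^ 2) := by
  rw [Real.enorm_eq_ofReal_abs, ← ENNReal.ofReal_pow (abs_nonneg r), sq_abs]

end approximation

/-! ### From finitely many digits to integrable functions on the cube -/

namespace IsNestedUniformScrambling

open Filter Topology

theorem measurePreserving_scrambleDigits {ι Ω : Type*} [Countable ι] [MeasurableSpace Ω]
    {μ : Measure Ω} {σ : ι → List (ZMod 2) → Ω → Equiv.Perm (ZMod 2)}
    (h : IsNestedUniformScrambling μ σ)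
    (x : ι → ℕ → ZMod 2) :
    MeasurePreserving (scrambleDigits σ x) μ (uniformDigits (ι × ℕ)) :=
  ⟨h.measurable_scrambleDigits x, h.map_scrambleDigits x⟩

theorem measurePreserving_scrambledSobol {ι Ω : Type*} [Fintype ι] [MeasurableSpace Ω]
    {μ : Measure Ω} {σ : ι → List (ZMod 2) → Ω → Equiv.Perm (ZMod 2)}
    (h : IsNestedUniformScrambling μ σ) (S : SobolDesign ι)
    (m : ℕ) : MeasurePreserving (scrambledSobol S σ m) μ (volume.restrict (Set.Icc 0 1)) := by
  have h1 : scrambledSobol S σ m = cubePoint ∘ scrambleDigits σ fun i => sobolDigit S i m := by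
    funext ω i
    rfl
  rw [h1]
  exact (MeasurePreserving.mk measurable_cubePoint map_cubePoint).comp
    (h.measurePreserving_scrambleDigits fun i => sobolDigit S i m)

variable {ι Ω : Type*} [Fintype ι] [MeasurableSpace Ω] {μ : Measure Ω} [IsProbabilityMeasure μ]
  {σ : ι → List (ZMod 2) → Ω → Equiv.Perm (ZMod 2)}

theorem lintegral_sq_sum_le_of_dependsOn (h : IsNestedUniformScrambling μ σ)
    (S : SobolDesign ι) (T : Finset (ι × ℕ))
    (f : (ι × ℕ → ZMod 2) → ℝ) (hf : DependsOn f (T : Set (ι × ℕ))) (n : ℕ) :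
    ∫⁻ ω, ‖∑ m ∈ Finset.range n, (f (scrambleDigits σ (fun i => sobolDigit S i m) ω) -
        ∫ z, f z ∂(uniformDigits (ι × ℕ)))‖ₑ ^ 2 ∂μ ≤
      ENNReal.ofReal (S.gain * n) * ∫⁻ z, ‖f z - ∫ z, f z ∂(uniformDigits (ι × ℕ))‖ₑ ^ 2
        ∂(uniformDigits (ι × ℕ)) := by
  classical
  have key := h.integral_sq_sum_le_of_dependsOn S T f hf n
  obtain ⟨hfm, C, hC⟩ := hf.measurable_and_bounded
  set c := ∫ z, f z ∂(uniformDigits (ι × ℕ)) with hc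
  have hb : ∀ z, |f z - c| ≤ C + |c| := fun z => (abs_sub _ _).trans (by gcongr; exact hC z)
  have hb0 : 0 ≤ C + |c| := (abs_nonneg _).trans (hb 0)
  have hi1 : Integrable (fun z => (f z - c) ^ 2) (uniformDigits (ι × ℕ)) :=
    Integrable.of_bound ((hfm.sub_const c).pow_const 2).aestronglyMeasurable ((C + |c|) ^ 2)
      (.of_forall fun z => by
        rw [Real.norm_eq_abs, abs_pow]; exact pow_le_pow_left₀ (abs_nonneg _) (hb z) 2)
  have hi2 : Integrable (fun ω => (∑ m ∈ Finset.range n,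
      (f (scrambleDigits σ (fun i => sobolDigit S i m) ω) - c)) ^ 2) μ := by
    refine Integrable.of_bound ((Finset.measurable_fun_sum _ fun m _ =>
      (hfm.comp (h.measurable_scrambleDigits _)).sub_const c).pow_const 2).aestronglyMeasurable
        ((n * (C + |c|)) ^ 2) (.of_forall fun ω => ?_)
    rw [Real.norm_eq_abs, abs_pow]
    refine pow_le_pow_left₀ (abs_nonneg _) ((Finset.abs_sum_le_sum_abs _ _).trans ?_) 2
    refine (Finset.sum_le_sum fun m _ => hb _).trans_eq ?_
    rw [Finset.sum_const, Finset.card_range, nsmul_eq_mul]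
  simp only [enorm_sq_eq_ofReal]
  rw [← ofReal_integral_eq_lintegral_ofReal hi2 (.of_forall fun _ => sq_nonneg _),
    ← ofReal_integral_eq_lintegral_ofReal hi1 (.of_forall fun _ => sq_nonneg _),
    ← ENNReal.ofReal_mul (mul_nonneg S.gain_pos.le n.cast_nonneg)]
  exact ENNReal.ofReal_le_ofReal key

/-- The variance bound for integrable functions of the digits. -/
theorem lintegral_sq_sum_digits_le (h : IsNestedUniformScrambling μ σ) (S : SobolDesign ι)
    (F : (ι × ℕ → ZMod 2) → ℝ) (hF : Integrable F (uniformDigits (ι × ℕ))) (n : ℕ) :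
    ∫⁻ ω, ‖∑ m ∈ Finset.range n, (F (scrambleDigits σ (fun i => sobolDigit S i m) ω) -
        ∫ z, F z ∂(uniformDigits (ι × ℕ)))‖ₑ ^ 2 ∂μ ≤
      ENNReal.ofReal (S.gain * n) * ∫⁻ z, ‖F z - ∫ z, F z ∂(uniformDigits (ι × ℕ))‖ₑ ^ 2
        ∂(uniformDigits (ι × ℕ)) := by
  set P := uniformDigits (ι × ℕ) with hP
  set c := ∫ z, F z ∂P with hc
  set T : ℕ → Finset (ι × ℕ) := fun N => Finset.univ ×ˢ Finset.range N with hT_def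
  have hT : Monotone T := fun a b hab => Finset.product_subset_product_right (Finset.range_mono hab)
  have hex : ∀ e, ∃ N, e ∈ T N := fun e => ⟨e.2 + 1, by simp [hT_def]⟩
  set f : ℕ → (ι × ℕ → ZMod 2) → ℝ := fun N => P[F | digitFiltration T hT N] with hf_def
  have hdep : ∀ N, DependsOn (f N) (T N : Set (ι × ℕ)) := fun N =>
    StronglyMeasurable.dependsOn_of_piFinset (s := T N) stronglyMeasurable_condExp
  have hmean : ∀ N, ∫ z, f N z ∂P = c := fun N => integral_condExp ((digitFiltration T hT).le N)
  have hlim := tendsto_ae_condExp_digitFiltration T hT hex P F hF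
  -- Almost everywhere convergence passes to the scrambled points because each of them has the
  -- uniform law.
  have hlim' : ∀ᵐ ω ∂μ, ∀ m ∈ Finset.range n, Tendsto
      (fun N => f N (scrambleDigits σ (fun i => sobolDigit S i m) ω)) atTop
      (𝓝 (F (scrambleDigits σ (fun i => sobolDigit S i m) ω))) :=
    (ae_ball_iff (Finset.range n).countable_toSet).2 fun m _ =>
      (h.measurePreserving_scrambleDigits _).quasiMeasurePreserving.ae hlim
  -- Fatou's lemma along the approximations, which all have the mean `c`.
  calc ∫⁻ ω, ‖∑ m ∈ Finset.range n, (F (scrambleDigits σ (fun i => sobolDigit S i m) ω) - c)‖ₑ ^ 2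
        ∂μ
      = ∫⁻ ω, liminf (fun N => ‖∑ m ∈ Finset.range n,
          (f N (scrambleDigits σ (fun i => sobolDigit S i m) ω) - c)‖ₑ ^ 2) atTop ∂μ := by
        refine lintegral_congr_ae ?_
        filter_upwards [hlim'] with ω hω
        refine (Tendsto.liminf_eq ?_).symm
        exact ((ENNReal.continuous_pow 2).comp continuous_enorm).tendsto _ |>.comp
          (tendsto_finsetSum _ fun m hm => (hω m hm).sub_const c)
    _ ≤ liminf (fun N => ∫⁻ ω, ‖∑ m ∈ Finset.range n,
          (f N (scrambleDigits σ (fun i => sobolDigit S i m) ω) - c)‖ₑ ^ 2 ∂μ) atTop := by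
        refine lintegral_liminf_le' fun N => ?_
        have := (hdep N).measurable_and_bounded.1
        exact ((Finset.measurable_fun_sum _ fun m _ =>
          (this.comp (h.measurable_scrambleDigits _)).sub_const c).enorm.pow_const 2).aemeasurable
    _ ≤ liminf (fun _ : ℕ => ENNReal.ofReal (S.gain * n) * ∫⁻ z, ‖F z - c‖ₑ ^ 2 ∂P) atTop := by
        refine liminf_le_liminf (.of_forall fun N => ?_)
        have := h.lintegral_sq_sum_le_of_dependsOn S (T N) (f N) (hdep N) n
        rw [hmean] at this
        refine this.trans (mul_le_mul_right ?_ _)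
        exact lintegral_condExp_sub_sq_le P ((digitFiltration T hT).le N) F hF c
    _ = _ := liminf_const _

/-- The variance bound for integrable functions on the cube. -/
theorem lintegral_sq_sum_le (h : IsNestedUniformScrambling μ σ) (S : SobolDesign ι)
    (F : (ι → ℝ) → ℝ) (hF : Integrable F (volume.restrict (Set.Icc 0 1))) (n : ℕ) :
    ∫⁻ ω, ‖∑ m ∈ Finset.range n, (F (scrambledSobol S σ m ω) -
        ∫ u, F u ∂(volume.restrict (Set.Icc 0 1)))‖ₑ ^ 2 ∂μ ≤
      ENNReal.ofReal (S.gain * n) *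
        ∫⁻ u, ‖F u - ∫ u, F u ∂(volume.restrict (Set.Icc 0 1))‖ₑ ^ 2
          ∂(volume.restrict (Set.Icc 0 1)) := by
  have hmp : MeasurePreserving (cubePoint (ι := ι)) (uniformDigits (ι × ℕ))
      (volume.restrict (Set.Icc 0 1)) := ⟨measurable_cubePoint, map_cubePoint⟩
  have key := h.lintegral_sq_sum_digits_le S (F ∘ cubePoint) (hmp.integrable_comp_of_integrable hF) n
  have hint : ∫ z, (F ∘ cubePoint) z ∂(uniformDigits (ι × ℕ)) =
      ∫ u, F u ∂(volume.restrict (Set.Icc 0 1)) := by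
    rw [← map_cubePoint, integral_map measurable_cubePoint.aemeasurable]
    · rfl
    · rw [map_cubePoint]; exact hF.1
  rw [hint] at key
  refine key.trans_eq ?_
  congr 1
  rw [← map_cubePoint, lintegral_map' _ measurable_cubePoint.aemeasurable]
  · rfl
  · rw [map_cubePoint]
    exact (hF.1.sub aestronglyMeasurable_const).enorm.pow_const 2

/-- The variance bound for functions with values in a Euclidean space. -/
theorem lintegral_enorm_sq_sum_le {E κ : Type*} [NormedAddCommGroup E] [NormedSpace ℝ E]
    [CompleteSpace E] [Fintype κ] (ℓ : κ → E →L[ℝ] ℝ) (hℓ : ∀ v, ‖v‖ₑ ^ 2 = ∑ k, ‖ℓ k v‖ₑ ^ 2)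
    (h : IsNestedUniformScrambling μ σ) (S : SobolDesign ι)
    (F : (ι → ℝ) → E) (hF : Integrable F (volume.restrict (Set.Icc 0 1))) (n : ℕ) :
    ∫⁻ ω, ‖∑ m ∈ Finset.range n, (F (scrambledSobol S σ m ω) -
        ∫ u, F u ∂(volume.restrict (Set.Icc 0 1)))‖ₑ ^ 2 ∂μ ≤
      ENNReal.ofReal (S.gain * n) *
        ∫⁻ u, ‖F u - ∫ u, F u ∂(volume.restrict (Set.Icc 0 1))‖ₑ ^ 2
          ∂(volume.restrict (Set.Icc 0 1)) := by
  simp only [hℓ, map_sum, map_sub]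
  have hm : ∀ k, AEMeasurable (fun u => ‖ℓ k (F u) -
      ℓ k (∫ u, F u ∂(volume.restrict (Set.Icc 0 1)))‖ₑ ^ 2) (volume.restrict (Set.Icc 0 1)) :=
    fun k => (((ℓ k).continuous.comp_aestronglyMeasurable hF.1).sub
      aestronglyMeasurable_const).enorm.pow_const 2
  have hm' : ∀ k, AEMeasurable (fun ω => ‖∑ m ∈ Finset.range n, (ℓ k (F (scrambledSobol S σ m ω)) -
      ℓ k (∫ u, F u ∂(volume.restrict (Set.Icc 0 1))))‖ₑ ^ 2) μ := fun k =>
    (Finset.aestronglyMeasurable_fun_sum _ fun m _ => (((ℓ k).continuous.comp_aestronglyMeasurable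
      (hF.1.comp_measurePreserving (h.measurePreserving_scrambledSobol S m))).sub
        aestronglyMeasurable_const)).enorm.pow_const 2
  rw [lintegral_finsetSum' _ fun k _ => hm k, lintegral_finsetSum' _ fun k _ => hm' k,
    Finset.mul_sum]
  refine Finset.sum_le_sum fun k _ => ?_
  rw [← (ℓ k).integral_comp_comm hF]
  exact h.lintegral_sq_sum_le S (fun u => ℓ k (F u)) ((ℓ k).integrable_comp hF) n

end IsNestedUniformScrambling

/-! ## The estimator in the Clifford algebra -/

section clifford

variable {p q r : ℕ}

instance : FiniteDimensional ℝ (Cl p q r) := Module.Finite.of_basis (bladeBasis p q r)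

instance : CompleteSpace (Cl p q r) := FiniteDimensional.complete ℝ _

/-- The coordinates of a multivector, as continuous linear functionals. -/
noncomputable def bladeCoord (I : BladeIndex p q r) : Cl p q r →L[ℝ] ℝ :=
  LinearMap.toContinuousLinearMap ((bladeBasis p q r).coord I)

theorem enorm_sq_eq_sum_bladeCoord (v : Cl p q r) : ‖v‖ₑ ^ 2 = ∑ I, ‖bladeCoord I v‖ₑ ^ 2 := by
  have h : ‖v‖ ^ 2 = ∑ I, bladeCoord I v ^ 2 := EuclideanSpace.real_norm_sq_eq _
  simp only [enorm_sq_eq_ofReal]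
  rw [← ENNReal.ofReal_sum_of_nonneg fun _ _ => sq_nonneg _, ← h, ← ofReal_norm,
    ENNReal.ofReal_pow (norm_nonneg _)]

/-- The geometric product as a continuous bilinear map. -/
noncomputable def geometricProduct (p q r : ℕ) : Cl p q r →L[ℝ] Cl p q r →L[ℝ] Cl p q r :=
  LinearMap.toContinuousBilinearMap (LinearMap.mul ℝ (Cl p q r))

/-- The Euclidean norm of coordinates need not be submultiplicative; the operator norm of the
product supplies the constant. -/
theorem norm_mul_le_geometricProduct (a b : Cl p q r) :
    ‖a * b‖ ≤ ‖geometricProduct p q r‖ * ‖a‖ * ‖b‖ :=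
  (geometricProduct p q r).le_opNorm₂ a b

theorem continuous_multivector : Continuous (multivector p q r) := by
  unfold multivector
  fun_prop

theorem naiveRBF_eq (x : Cl p q r) : naiveRBF p q r x = Real.exp (-‖x‖ ^ 2) • 1 :=
  Algebra.algebraMap_eq_smul_one _

theorem cliffordRBF_eq (x : Cl p q r) : cliffordRBF p q r x = Real.exp (-‖x‖ ^ 2) • x := by
  rw [cliffordRBF, naiveRBF_eq, mul_smul_comm, mul_one]

theorem continuous_and_bounded_of_rbf {φ : Cl p q r → Cl p q r}
    (hφ : φ = naiveRBF p q r ∨ φ = cliffordRBF p q r) :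
    Continuous φ ∧ ∃ B, 0 ≤ B ∧ ∀ x, ‖φ x‖ ≤ B := by
  rcases hφ with rfl | rfl
  · rw [funext naiveRBF_eq]
    refine ⟨by fun_prop, ‖(1 : Cl p q r)‖, norm_nonneg _, fun x => ?_⟩
    rw [norm_smul, Real.norm_eq_abs, Real.abs_exp]
    exact mul_le_of_le_one_left (norm_nonneg _) (Real.exp_le_one_iff.2 (by simp))
  · rw [funext cliffordRBF_eq]
    refine ⟨by fun_prop, 1, zero_le_one, fun x => ?_⟩
    rw [norm_smul, Real.norm_eq_abs, Real.abs_exp, Real.exp_neg, inv_mul_le_one₀ (Real.exp_pos _)]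
    -- `‖x‖ ≤ ‖x‖² + 1 ≤ exp ‖x‖²`.
    have := Real.add_one_le_exp (‖x‖ ^ 2)
    nlinarith [sq_nonneg (‖x‖ - 1)]

instance : IsProbabilityMeasure (cubeMeasure p q r) := ⟨by
  rw [cubeMeasure, Measure.restrict_apply_univ, Real.volume_Icc_pi]
  simp⟩

variable {Ω : Type*}

theorem sobolActivation_eq (S : SobolDesign (BladeIndex p q r))
    (σ : BladeIndex p q r → List (ZMod 2) → Ω → Equiv.Perm (ZMod 2))
    (g φ : Cl p q r → Cl p q r) (n : ℕ) (x : Cl p q r) (ω : Ω) :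
    sobolActivation S σ g φ n x ω = (n : ℝ)⁻¹ • ∑ m ∈ Finset.range n,
      convIntegrand g φ x (scrambledSobol S σ m ω) := by
  rw [sobolActivation, activation, Finset.smul_sum, Finset.sum_range]
  refine Finset.sum_congr rfl fun m _ => ?_
  rw [smul_mul_assoc]
  rfl

theorem sobolActivation_sub_eq (S : SobolDesign (BladeIndex p q r))
    (σ : BladeIndex p q r → List (ZMod 2) → Ω → Equiv.Perm (ZMod 2))
    (g φ : Cl p q r → Cl p q r) {n : ℕ} (hn : 0 < n) (x h : Cl p q r) (ω : Ω) :
    sobolActivation S σ g φ n x ω - h = (n : ℝ)⁻¹ • ∑ m ∈ Finset.range n,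
      (convIntegrand g φ x (scrambledSobol S σ m ω) - h) := by
  rw [sobolActivation_eq, Finset.sum_sub_distrib, smul_sub, Finset.sum_const, Finset.card_range,
    ← Nat.cast_smul_eq_nsmul ℝ, inv_smul_smul₀ (by positivity)]

variable [MeasurableSpace Ω] {μ : Measure Ω}
  {σ : BladeIndex p q r → List (ZMod 2) → Ω → Equiv.Perm (ZMod 2)}

theorem measurePreserving_scrambledSobol_cube (hσ : IsNestedUniformScrambling μ σ)
    (S : SobolDesign (BladeIndex p q r)) (m : ℕ) :
    MeasurePreserving (scrambledSobol S σ m) μ (cubeMeasure p q r) :=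
  hσ.measurePreserving_scrambledSobol S m

theorem memLp_sobolActivation (hσ : IsNestedUniformScrambling μ σ)
    (S : SobolDesign (BladeIndex p q r)) {g φ : Cl p q r → Cl p q r} {x : Cl p q r}
    {s : ENNReal} (hf : MemLp (convIntegrand g φ x) s (cubeMeasure p q r)) (n : ℕ) :
    MemLp (sobolActivation S σ g φ n x) s μ := by
  rw [funext (sobolActivation_eq S σ g φ n x)]
  have h : MemLp (fun ω => ∑ m ∈ Finset.range n,
      convIntegrand g φ x (scrambledSobol S σ m ω)) s μ := memLp_finsetSum _ fun m _ =>
    hf.comp_measurePreserving (measurePreserving_scrambledSobol_cube hσ S m)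
  exact h.const_smul (n : ℝ)⁻¹

/-- The estimator is unbiased. -/
theorem integral_sobolActivation (hσ : IsNestedUniformScrambling μ σ)
    (S : SobolDesign (BladeIndex p q r)) {g φ : Cl p q r → Cl p q r} {x : Cl p q r}
    (hf : Integrable (convIntegrand g φ x) (cubeMeasure p q r)) {n : ℕ} (hn : 0 < n) :
    ∫ ω, sobolActivation S σ g φ n x ω ∂μ = cubeConvolution g φ x := by
  have h1 : ∀ m, ∫ ω, convIntegrand g φ x (scrambledSobol S σ m ω) ∂μ = cubeConvolution g φ x := by
    intro m
    have hmp := measurePreserving_scrambledSobol_cube hσ S m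
    rw [cubeConvolution, ← hmp.map_eq, integral_map hmp.measurable.aemeasurable]
    rw [hmp.map_eq]
    exact hf.1
  have h2 : ∀ m, Integrable (fun ω => convIntegrand g φ x (scrambledSobol S σ m ω)) μ := fun m =>
    (measurePreserving_scrambledSobol_cube hσ S m).integrable_comp_of_integrable hf
  simp only [sobolActivation_eq]
  rw [integral_smul, integral_finsetSum _ fun m _ => h2 m]
  simp only [h1]
  rw [Finset.sum_const, Finset.card_range, ← Nat.cast_smul_eq_nsmul ℝ,
    inv_smul_smul₀ (by positivity)]

theorem lintegral_sobolActivation_sub_le [IsProbabilityMeasure μ]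
    (hσ : IsNestedUniformScrambling μ σ)
    (S : SobolDesign (BladeIndex p q r)) {g φ : Cl p q r → Cl p q r} {x : Cl p q r}
    (hf : Integrable (convIntegrand g φ x) (cubeMeasure p q r)) {n : ℕ} (hn : 0 < n) :
    ∫⁻ ω, ‖sobolActivation S σ g φ n x ω - cubeConvolution g φ x‖ₑ ^ 2 ∂μ ≤
      ENNReal.ofReal (S.gain / n) *
        ∫⁻ u, ‖convIntegrand g φ x u - cubeConvolution g φ x‖ₑ ^ 2 ∂(cubeMeasure p q r) := by
  simp only [sobolActivation_sub_eq S σ g φ hn, enorm_smul, mul_pow]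
  rw [lintegral_const_mul' _ _ (by simp)]
  have key := IsNestedUniformScrambling.lintegral_enorm_sq_sum_le bladeCoord
    enorm_sq_eq_sum_bladeCoord hσ S (convIntegrand g φ x) hf n
  refine (mul_le_mul_right key _).trans_eq ?_
  have hn' : (n : ℝ) ≠ 0 := by positivity
  rw [← mul_assoc, enorm_sq_eq_ofReal, ← ENNReal.ofReal_mul (sq_nonneg _)]
  congr 2
  field_simp

/-- On a probability space the mean is bounded by the `L¹` norm, hence by the `L²` norm; the
triangle inequality then gives the factor `2`. -/
theorem lintegral_convIntegrand_sub_le {g φ : Cl p q r → Cl p q r} {x : Cl p q r}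
    (hf : MemLp (convIntegrand g φ x) 2 (cubeMeasure p q r)) :
    ∫⁻ u, ‖convIntegrand g φ x u - cubeConvolution g φ x‖ₑ ^ 2 ∂(cubeMeasure p q r) ≤
      (2 * eLpNorm (convIntegrand g φ x) 2 (cubeMeasure p q r)) ^ 2 := by
  rw [lintegral_enorm_sq_eq]
  gcongr
  have h1 : eLpNorm (fun _ : BladeIndex p q r → ℝ => cubeConvolution g φ x) 2 (cubeMeasure p q r) ≤
      eLpNorm (convIntegrand g φ x) 2 (cubeMeasure p q r) := by
    rw [eLpNorm_const _ (by norm_num) (IsProbabilityMeasure.ne_zero _), measure_univ,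
      ENNReal.one_rpow, mul_one]
    refine (enorm_integral_le_lintegral_enorm _).trans ?_
    rw [← eLpNorm_one_eq_lintegral_enorm]
    exact eLpNorm_le_eLpNorm_of_exponent_le (by norm_num) hf.1
  refine (eLpNorm_sub_le hf.1 aestronglyMeasurable_const (by norm_num)).trans ?_
  rw [two_mul]
  gcongr

end clifford

/-- For the scrambled Sobol grid of size `n` in `Cl(p,q,r)`, the activation with weights
`g(y) / n` is an unbiased estimator of `h`, and its variance is `O(1/n)`. -/
theorem mainTheorem1 (p q r : ℕ) (S : SobolDesign (BladeIndex p q r)) :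
    ∃ Γ : ℝ, 0 < Γ ∧
      -- any kernel: unbiased, with variance at most `Γ σ²(f_x) / n`
      (∀ (g φ : Cl p q r → Cl p q r) (x : Cl p q r),
        Integrable (convIntegrand g φ x) (cubeMeasure p q r) →
        ∀ (n : ℕ), 0 < n →
        ∀ (Ω : Type*) [MeasurableSpace Ω] (μ : Measure Ω) [IsProbabilityMeasure μ]
          (σ : BladeIndex p q r → List (ZMod 2) → Ω → Equiv.Perm (ZMod 2)),
          IsNestedUniformScrambling μ σ →
          Integrable (sobolActivation S σ g φ n x) μ ∧
          ∫ ω, sobolActivation S σ g φ n x ω ∂μ = cubeConvolution g φ x ∧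
          ∫⁻ ω, ‖sobolActivation S σ g φ n x ω - cubeConvolution g φ x‖ₑ ^ 2 ∂μ
            ≤ ENNReal.ofReal (Γ / n) *
              ∫⁻ u, ‖convIntegrand g φ x u - cubeConvolution g φ x‖ₑ ^ 2 ∂(cubeMeasure p q r)) ∧
      -- the two radial basis functions: unbiased, with variance `O(1/n)` uniformly in `x`
      (∀ φ : Cl p q r → Cl p q r, φ = naiveRBF p q r ∨ φ = cliffordRBF p q r →
        ∀ g : Cl p q r → Cl p q r,
        MemLp (fun u => g (multivector p q r u)) 2 (cubeMeasure p q r) →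
        ∃ C : ℝ, ∀ (x : Cl p q r) (n : ℕ), 0 < n →
        ∀ (Ω : Type*) [MeasurableSpace Ω] (μ : Measure Ω) [IsProbabilityMeasure μ]
          (σ : BladeIndex p q r → List (ZMod 2) → Ω → Equiv.Perm (ZMod 2)),
          IsNestedUniformScrambling μ σ →
          MemLp (sobolActivation S σ g φ n x) 2 μ ∧
          ∫ ω, sobolActivation S σ g φ n x ω ∂μ = cubeConvolution g φ x ∧
          ∫ ω, ‖sobolActivation S σ g φ n x ω - cubeConvolution g φ x‖ ^ 2 ∂μ ≤ C / n) := by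
  refine ⟨S.gain, S.gain_pos, ?_, ?_⟩
  · intro g φ x hf n hn Ω _ μ _ σ hσ
    exact ⟨memLp_one_iff_integrable.1
      (memLp_sobolActivation hσ S (memLp_one_iff_integrable.2 hf) n),
      integral_sobolActivation hσ S hf hn, lintegral_sobolActivation_sub_le hσ S hf hn⟩
  · intro φ hφ g hg
    obtain ⟨hcont, B, hB0, hB⟩ := continuous_and_bounded_of_rbf hφ
    set K := ‖geometricProduct p q r‖ * B with hK
    set N := (eLpNorm (fun u => g (multivector p q r u)) 2 (cubeMeasure p q r)).toReal with hN
    -- `K * N` bounds the `L²` norm of the integrand for every `x`, since `φ` is bounded by `B`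
    -- everywhere; the `2` accounts for subtracting the mean.
    refine ⟨S.gain * (2 * (K * N)) ^ 2, fun x n hn Ω _ μ _ σ hσ => ?_⟩
    have hle : ∀ u, ‖convIntegrand g φ x u‖ ≤ K * ‖g (multivector p q r u)‖ := fun u => by
      refine (norm_mul_le_geometricProduct _ _).trans ?_
      rw [hK, mul_right_comm]
      gcongr
      exact hB _
    have hmeas : AEStronglyMeasurable (convIntegrand g φ x) (cubeMeasure p q r) := by
      have h1 : Continuous fun u => φ (x - multivector p q r u) :=
        hcont.comp (continuous_const.sub continuous_multivector)
      exact (geometricProduct p q r).aestronglyMeasurable_comp₂ hg.1 h1.aestronglyMeasurable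
    have hf : MemLp (convIntegrand g φ x) 2 (cubeMeasure p q r) :=
      hg.of_le_mul hmeas (.of_forall hle)
    have hint : Integrable (convIntegrand g φ x) (cubeMeasure p q r) := hf.integrable (by norm_num)
    have hmem := memLp_sobolActivation hσ S hf n
    refine ⟨hmem, integral_sobolActivation hσ S hint hn, ?_⟩
    have hn' : (0 : ℝ) < n := by positivity
    have hnorm : eLpNorm (convIntegrand g φ x) 2 (cubeMeasure p q r) ≤ ENNReal.ofReal (K * N) := by
      refine (eLpNorm_le_mul_eLpNorm_of_ae_le_mul (.of_forall hle) 2).trans_eq ?_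
      rw [ENNReal.ofReal_mul (p := K) (by positivity), hN, ENNReal.ofReal_toReal hg.2.ne]
    have hsub : AEStronglyMeasurable
        (fun ω => sobolActivation S σ g φ n x ω - cubeConvolution g φ x) μ :=
      hmem.1.sub aestronglyMeasurable_const
    rw [integral_eq_lintegral_of_nonneg_ae (.of_forall fun _ => sq_nonneg _) (hsub.norm.pow 2)]
    refine ENNReal.toReal_le_of_le_ofReal
      (div_nonneg (mul_nonneg S.gain_pos.le (sq_nonneg _)) hn'.le) ?_
    simp only [ENNReal.ofReal_pow (norm_nonneg _), ofReal_norm]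
    refine (lintegral_sobolActivation_sub_le hσ S hint hn).trans ?_
    rw [mul_div_right_comm, ENNReal.ofReal_mul (div_nonneg S.gain_pos.le hn'.le)]
    gcongr
    refine (lintegral_convIntegrand_sub_le hf).trans ?_
    rw [ENNReal.ofReal_pow (by positivity), ENNReal.ofReal_mul (by norm_num : (0:ℝ) ≤ 2),
      ENNReal.ofReal_ofNat]
    gcongr
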